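/- Let $a,b,c,d\in\mathbb C$ be such that none of $a+b$, $a+c$, $1+a-d$ lies in $\{0,-1,-2,\dots\}$, and put \[ \tilde a=\tfrac12(a+b+c+d-1),\quad \tilde b=\tfrac12(a+b-c-d+1),\quad \tilde c=\tfrac12(a-b+c-d+1),\quad \tilde d=\tfrac12(a-b-c+d+1). \] Write \[ W(\alpha;\beta,\gamma,\delta,\epsilon,\zeta)={}_7F_6\!\left(\begin{matrix}\alpha,\,1+\frac\alpha2,\,\beta,\,\gamma,\,\delta,\,\epsilon,\,\zeta\\ \frac\alpha2,\,1+\alpha-\beta,\,1+\alpha-\gamma,\,1+\alpha-\delta,\,1+\alpha-\epsilon,\,1+\alpha-\zeta\end{matrix};1\right). \] The Wilson function is the function \[ \phi_\lambda(x)=\frac{\Gamma(\tilde a+\tilde b+\tilde c+i\lambda)\;W(\tilde a+\tilde b+\tilde c-1+i\lambda;\,a+ix,\,a-ix,\,\tilde a+i\lambda,\,\tilde b+i\lambda,\,\tilde c+i\lambda)}{\Gamma(a+b)\Gamma(a+c)\Gamma(1+a-d)\Gamma(1-\tilde d-i\lambda)\Gamma(\tilde b+c+i\lambda+ix)\Gamma(\tilde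 b+c+i\lambda-ix)}. \] The series converges absolutely, and the expression makes sense, for all $(\lambda,x)\in\mathbb C^2$ such that $\Re(1-\tilde d-i\lambda)>0$ and none of $\tilde a+\tilde b+\tilde c-1+i\lambda$, $\tilde b+c+i\lambda+ix$, $\tilde b+c+i\lambda-ix$ lies in $\{0,-1,-2,\dots\}$. There is exactly one entire function of $(\lambda,x)\in\mathbb C^2$ that agrees with this expression at all these points; it is again denoted by $\phi_\lambda(x)$. Let \[ A(x)=\frac{(a+ix)(b+ix)(c+ix)(d+ix)}{2ix(2ix+1)},\qquad B(x)=\frac{(a+ix)(b+ix)(c+ix)(1-d+ix)}{2ix(2ix+1)}, \] and let $L$ be the difference operator \[ L=B(-x)T_i+\big[A(-x)+A(x)\big]I+B(x)T_{-i},\qquad (T_zf)(x)=f(x+z). \] Then, for all $\lambda\in\mathbb C$ and all $x\in\mathbb C\setminus\{0,\frac i2,-\frac i2\}$ (the points at which the coefficients of $L$ are defined), \[ (L\phi_\lambda)(x)=(\lambda^2+\tilde a^2)\,\phi_\lambda(x). \] -/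

import Mathlib

open Complex

noncomputable section

/-- The `n`-th term of the hypergeometric series with upper parameters `as`, lower parameters
`bs` and argument `z`, where `(u)_n = u (u + 1) ⋯ (u + n - 1)`. -/
def hypergeometricTerm (as bs : List ℂ) (z : ℂ) (n : ℕ) : ℂ :=
  (as.map fun u => (ascPochhammer ℂ n).eval u).prod /
    (bs.map fun u => (ascPochhammer ℂ n).eval u).prod * (z ^ n / (n.factorial : ℂ))

/-- The terms of the very-well-poised series `W(a; b, c, d, e, f)`, a `₇F₆`-series of
argument `1`, in Bailey's notation. -/
def baileyWTerm (a b c d e f : ℂ) : ℕ → ℂ :=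
  hypergeometricTerm [a, 1 + a / 2, b, c, d, e, f]
    [a / 2, 1 + a - b, 1 + a - c, 1 + a - d, 1 + a - e, 1 + a - f] 1

/-- The sum `W(a; b, c, d, e, f)` of the very-well-poised `₇F₆`-series of argument `1`. -/
def baileyW (a b c d e f : ℂ) : ℂ := ∑' n : ℕ, baileyWTerm a b c d e f n

/-- The dual parameter `ã`. -/
def dualA (a b c d : ℂ) : ℂ := (a + b + c + d - 1) / 2

/-- The dual parameter `b̃`. -/
def dualB (a b c d : ℂ) : ℂ := (a + b - c - d + 1) / 2

/-- The dual parameter `c̃`. -/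
def dualC (a b c d : ℂ) : ℂ := (a - b + c - d + 1) / 2

/-- The dual parameter `d̃`. -/
def dualD (a b c d : ℂ) : ℂ := (a - b - c + d + 1) / 2

/-- `z` is not one of `0, -1, -2, …`. -/
def NotNonposInt (z : ℂ) : Prop := ∀ n : ℕ, z ≠ -(n : ℂ)

/-- The first parameter `ã + b̃ + c̃ - 1 + iλ` of the `₇F₆`-series in the Wilson function. -/
def wilsonBase (a b c d l : ℂ) : ℂ :=
  dualA a b c d + dualB a b c d + dualC a b c d - 1 + I * l

/-- The terms of the series
`W(ã + b̃ + c̃ - 1 + iλ; a + ix, a - ix, ã + iλ, b̃ + iλ, c̃ + iλ)`. -/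
def wilsonTerm (a b c d l x : ℂ) : ℕ → ℂ :=
  baileyWTerm (wilsonBase a b c d l) (a + I * x) (a - I * x)
    (dualA a b c d + I * l) (dualB a b c d + I * l) (dualC a b c d + I * l)

/-- The explicit expression, a quotient of Gamma functions times a very-well-poised
`₇F₆`-series, that defines the Wilson function at the points of `wilsonDomain`. -/
def wilsonFormula (a b c d l x : ℂ) : ℂ :=
  Gamma (dualA a b c d + dualB a b c d + dualC a b c d + I * l) /
    (Gamma (a + b) * Gamma (a + c) * Gamma (1 + a - d) * Gamma (1 - dualD a b c d - I * l) *
      (Gamma (dualB a b c d + c + I * l + I * x) * Gamma (dualB a b c d + c + I * l - I * x))) *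
  baileyW (wilsonBase a b c d l) (a + I * x) (a - I * x)
    (dualA a b c d + I * l) (dualB a b c d + I * l) (dualC a b c d + I * l)

/-- The points `(λ, x)` at which every factor of `wilsonFormula` makes sense (given that `a + b`,
`a + c`, `1 + a - d`, which are also lower parameters of the series, are not in `{0, -1, …}`):
the series converges, the remaining lower parameters
are not in `{0, -1, …}`, and the Gamma function in the numerator has no pole. -/
def wilsonDomain (a b c d : ℂ) : Set (ℂ × ℂ) :=
  {p | 0 < (1 - dualD a b c d - I * p.1).re ∧
    NotNonposInt (wilsonBase a b c d p.1) ∧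
    NotNonposInt (dualB a b c d + c + I * p.1 + I * p.2) ∧
    NotNonposInt (dualB a b c d + c + I * p.1 - I * p.2)}

/-- `φ` (written `φ l x` for `φ_λ(x)`) is the Wilson function with parameters `a, b, c, d`:
the entire function of `(λ, x) ∈ ℂ²` given by the `₇F₆`-expression wherever that makes sense. -/
structure IsWilsonFunction (a b c d : ℂ) (φ : ℂ → ℂ → ℂ) : Prop where
  entire : Differentiable ℂ fun p : ℂ × ℂ => φ p.1 p.2
  eq_formula : ∀ l x : ℂ, (l, x) ∈ wilsonDomain a b c d → φ l x = wilsonFormula a b c d l x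

/-- The coefficient `A(x)`. -/
def coeffA (a b c d x : ℂ) : ℂ :=
  ((a + I * x) * (b + I * x) * (c + I * x) * (d + I * x)) / (2 * I * x * (2 * I * x + 1))

/-- The coefficient `B(x)`. -/
def coeffB (a b c d x : ℂ) : ℂ :=
  ((a + I * x) * (b + I * x) * (c + I * x) * (1 - d + I * x)) / (2 * I * x * (2 * I * x + 1))

/-- The shift operator `(T_z f)(x) = f(x + z)`. -/
def shiftOp (z : ℂ) (f : ℂ → ℂ) : ℂ → ℂ := fun x => f (x + z)

/-- The difference operator `L = B(-x) T_i + [A(-x) + A(x)] I + B(x) T_{-i}`. -/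
def wilsonL (a b c d : ℂ) (f : ℂ → ℂ) : ℂ → ℂ := fun x =>
  coeffB a b c d (-x) * shiftOp I f x + (coeffA a b c d (-x) + coeffA a b c d x) * f x +
    coeffB a b c d x * shiftOp (-I) f x

end

/-!
Write `α` for `wilsonBase`, `β` for the other five upper parameters and `σ = 1 - d̃ - iλ`. The
formula for the Wilson function is `Γ(α) / Γ(σ)` times the sum of the very-well-poised terms
`T n = (α + 2n) (α)ₙ ∏ (β)ₙ / (n! ∏ Γ(1 + α - β + n))`, which are entire in `(λ, x)` and decay like
`n ^ (-1 - 2σ)`, uniformly for bounded parameters (`exists_norm_wellPoised_le`).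

Everything rests on one telescoping relation. In the variable `N = n + α / 2` the ratio of
consecutive values of `T n / (2N)` is `∏ (N + u) / ∏ (N + 1 - u)`, so that `T n / (2N)` times
`∏ (N + u) - ∏ (N - u)` is a difference `G (n + 1) - G n` (`IsWellPoised.mul_wpLow_succ`).
Divided by `2N`, this odd polynomial becomes a quadratic polynomial in `N²`, with leading
coefficient `2 - σ`.

*Analytic continuation.* Lowering the parameter `b` by one divides `T n` by a quadratic in `N`
which is a polynomial of degree one in `N²`, and raises `σ` by one. Lowering twice and subtracting
the telescoping relation therefore expresses `σ ∑ T n` through a boundary term and the sums of the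
once and the twice lowered series, with polynomial coefficients (`wpExcess_mul_wpTail`). The factor
`σ` is absorbed by `1 / Γ(σ)`, and `K` iterations continue the series, divided by `Γ(σ)`, to
`Re σ > -K`. Here the sums start at a large index, because the lowered terms of small index are not
entire. The continuation vanishes for `α = -m`: the tail contains the factor `(α)ₙ = 0`, and the
remaining finite sum is antisymmetric under `n ↦ m - n` (`sum_wpSeq_neg_natCast`). Hence the poles
of `Γ(α)` are removable, jointly in both variables by
`differentiableAt_of_differentiableAt_off_line`.

*Difference equation.* The terms at `x` and `x ± i` are multiples, by polynomials in `N²`, of the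
terms in which both `a + ix` and `a - ix` are lowered by one. The combination prescribed by the
operator and the eigenvalue is a constant multiple of the telescoping polynomial of these lowered
terms (`wilson_term_identity`), so its sum vanishes for `Re σ > 0` and generic `x`. Analyticity in
`λ` and continuity in `x` give the general case.
-/

section

open Filter Metric Set Topology

/-! ### Holomorphic functions of several variables -/

/-- A series of entire functions on a complex normed space that is dominated near `p₀`, from some
index on, by a convergent numerical series has a differentiable sum at `p₀`. The bound on the
derivatives comes from the Schwarz lemma. -/
theorem differentiableAt_tsum_of_norm_le {E : Type*} [NormedAddCommGroup E] [NormedSpace ℂ E]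
    {f : ℕ → E → ℂ} {u : ℕ → ℝ} {p₀ : E} {V : Set E} (hV : V ∈ 𝓝 p₀)
    (hf : ∀ n, Differentiable ℂ (f n)) (hu : Summable u) (k : ℕ)
    (hle : ∀ n, k ≤ n → ∀ p ∈ V, ‖f n p‖ ≤ u n) :
    DifferentiableAt ℂ (fun p => ∑' n, f n p) p₀ := by
  obtain ⟨R, hR, hRV⟩ := Metric.mem_nhds_iff.1 hV
  have huk : Summable fun n => u (n + k) := (summable_nat_add_iff k).2 hu
  have hr : 0 < R / 2 := by positivity
  have hsumm : ∀ p ∈ V, Summable fun n => f (n + k) p := fun p hp =>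
    Summable.of_norm_bounded huk fun n => hle _ (by omega) p hp
  have htail : HasFDerivAt (fun p => ∑' n, f (n + k) p)
      (∑' n, fderiv ℂ (f (n + k)) p₀) p₀ := by
    refine hasFDerivAt_tsum_of_isPreconnected (u := fun n => 2 * u (n + k) / (R / 2))
      (s := ball p₀ (R / 2)) (x₀ := p₀) ?_ isOpen_ball (convex_ball _ _).isPreconnected
      (f' := fun n => fderiv ℂ (f (n + k)))
      (fun n x _ => (hf _ x).hasFDerivAt) ?_ (mem_ball_self hr)
      (hsumm p₀ (mem_of_mem_nhds hV)) (mem_ball_self hr)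
    · exact (huk.mul_left 2).div_const _
    · intro n x hx
      have hsub : ball x (R / 2) ⊆ V := by
        refine subset_trans ?_ hRV
        refine ball_subset_ball' ?_
        have := mem_ball.1 hx
        linarith
      refine norm_fderiv_le_div_of_mapsTo_ball (hf _).differentiableOn ?_ hr
      intro y hy
      rw [mem_closedBall, dist_eq_norm]
      have h1 := hle (n + k) (by omega) y (hsub hy)
      have h2 := hle (n + k) (by omega) x (hsub (mem_ball_self hr))
      linarith [norm_sub_le (f (n + k) y) (f (n + k) x)]
  have hfin : DifferentiableAt ℂ (fun p => ∑ n ∈ Finset.range k, f n p) p₀ :=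
    DifferentiableAt.fun_sum fun n _ => hf n p₀
  refine (hfin.add htail.differentiableAt).congr_of_eventuallyEq ?_
  filter_upwards [hV] with p hp
  exact (((summable_nat_add_iff k).1 (hsumm p hp)).sum_add_tsum_nat_add k).symm

/-- **Osgood's lemma**: a bounded, separately holomorphic function of two variables is
differentiable. The mixed second difference `D` vanishes on both axes through the point, so that two
applications of the Schwarz lemma bound it by a multiple of the squared distance. -/
theorem differentiableAt_of_separately_of_bounded {u : ℂ × ℂ → ℂ} {z w : ℂ} {r M : ℝ}
    (hr : 0 < r)
    (h1 : ∀ y ∈ ball w r, DifferentiableOn ℂ (fun t => u (t, y)) (ball z r))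
    (h2 : ∀ t ∈ ball z r, DifferentiableOn ℂ (fun y => u (t, y)) (ball w r))
    (hM : ∀ t ∈ ball z r, ∀ y ∈ ball w r, ‖u (t, y)‖ ≤ M) :
    DifferentiableAt ℂ u (z, w) := by
  have hz : z ∈ ball z r := mem_ball_self hr
  have hw : w ∈ ball w r := mem_ball_self hr
  set D : ℂ × ℂ → ℂ := fun p => (u (p.1, p.2) - u (p.1, w)) - (u (z, p.2) - u (z, w)) with hD
  have hone : ∀ t ∈ ball z r, ∀ y ∈ ball w r,
      ‖u (t, y) - u (t, w)‖ ≤ 2 * M / r * dist y w := by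
    intro t ht y hy
    rw [← dist_eq_norm]
    refine dist_le_div_mul_dist_of_mapsTo_ball (f := fun y => u (t, y)) (h2 t ht) ?_ hy
    intro v hv
    rw [mem_closedBall, dist_eq_norm]
    linarith [norm_sub_le (u (t, v)) (u (t, w)), hM t ht v hv, hM t ht w hw]
  have htwo : ∀ t ∈ ball z r, ∀ y ∈ ball w r,
      ‖D (t, y)‖ ≤ 2 * (2 * M / r * dist y w) / r * dist t z := by
    intro t ht y hy
    have := dist_le_div_mul_dist_of_mapsTo_ball (f := fun t => u (t, y) - u (t, w)) (c := z)
      (R₁ := r) (R₂ := 2 * (2 * M / r * dist y w)) ((h1 y hy).sub (h1 w hw)) ?_ ht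
    · simpa [dist_eq_norm, hD] using this
    · intro v hv
      rw [mem_closedBall, dist_eq_norm]
      linarith [norm_sub_le (u (v, y) - u (v, w)) (u (z, y) - u (z, w)), hone v hv y hy,
        hone z hz y hy]
  have hDd : DifferentiableAt ℂ D (z, w) := by
    refine (Asymptotics.IsBigO.hasFDerivAt (n := 2) ?_ (by norm_num)).differentiableAt
    refine Asymptotics.IsBigO.of_bound (4 * M / r ^ 2) ?_
    have hnhds : ball z r ×ˢ ball w r ∈ 𝓝 (z, w) :=
      prod_mem_nhds (ball_mem_nhds _ hr) (ball_mem_nhds _ hr)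
    filter_upwards [hnhds] with p hp
    have hM0 : 0 ≤ M := (norm_nonneg _).trans (hM z hz w hw)
    have ha : dist p.1 z ≤ ‖p - (z, w)‖ := by
      rw [dist_eq_norm]; exact norm_fst_le (p - (z, w))
    have hb : dist p.2 w ≤ ‖p - (z, w)‖ := by
      rw [dist_eq_norm]; exact norm_snd_le (p - (z, w))
    calc ‖D p‖ ≤ 2 * (2 * M / r * dist p.2 w) / r * dist p.1 z := htwo p.1 hp.1 p.2 hp.2
      _ = 4 * M / r ^ 2 * (dist p.2 w * dist p.1 z) := by field_simp; ring
      _ ≤ 4 * M / r ^ 2 * ‖‖p - (z, w)‖ ^ 2‖ := by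
        rw [Real.norm_of_nonneg (by positivity), sq ‖p - (z, w)‖]
        gcongr
  have hA : DifferentiableAt ℂ (fun p : ℂ × ℂ => u (p.1, w)) (z, w) :=
    DifferentiableAt.comp (z, w) (g := fun t => u (t, w))
      ((h1 w hw).differentiableAt (ball_mem_nhds _ hr)) differentiableAt_fst
  have hB : DifferentiableAt ℂ (fun p : ℂ × ℂ => u (z, p.2)) (z, w) :=
    DifferentiableAt.comp (z, w) (g := fun y => u (z, y))
      ((h2 z hz).differentiableAt (ball_mem_nhds _ hr)) differentiableAt_snd
  have := ((hDd.add hA).add hB).sub_const (u (z, w))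
  refine this.congr_of_eventuallyEq (Eventually.of_forall fun p => ?_)
  simp only [hD, Prod.mk.eta, Pi.add_apply]
  ring

/-- Removable singularities along the line `{z} × ℂ` in two variables: holomorphy in the first
variable alone suffices there. The maximum principle in the first variable bounds the function,
the Schwarz lemma makes `u (z, ·)` a locally uniform limit of holomorphic functions, and Osgood's
lemma applies. -/
theorem differentiableAt_of_differentiableAt_off_line {u : ℂ × ℂ → ℂ} {z w : ℂ} {R : ℝ}
    (hR : 0 < R)
    (h1 : ∀ y ∈ ball w R, DifferentiableOn ℂ (fun t => u (t, y)) (ball z R))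
    (hoff : ∀ t ∈ ball z R, t ≠ z → ∀ y ∈ ball w R, DifferentiableAt ℂ u (t, y)) :
    DifferentiableAt ℂ u (z, w) := by
  set r := R / 2 with hr_def
  have hr : 0 < r := by positivity
  have hrR : r < R := by linarith
  have hbb : ∀ c : ℂ, ball c r ⊆ ball c R := fun c => ball_subset_ball hrR.le
  obtain ⟨M, hM⟩ : ∃ M, ∀ p ∈ sphere z r ×ˢ closedBall w r, ‖u p‖ ≤ M := by
    refine ((isCompact_sphere z r).prod (isCompact_closedBall w r)).exists_bound_of_continuousOn ?_
    rintro ⟨t, y⟩ ⟨ht, hy⟩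
    refine (hoff t ?_ ?_ y ?_).continuousAt.continuousWithinAt
    · exact mem_ball.2 ((mem_sphere.1 ht).trans_lt hrR)
    · rintro rfl
      simp only [mem_sphere, dist_self] at ht
      exact hr.ne ht
    · exact mem_ball.2 ((mem_closedBall.1 hy).trans_lt hrR)
  have hbd : ∀ t ∈ ball z r, ∀ y ∈ ball w r, ‖u (t, y)‖ ≤ M := by
    intro t ht y hy
    refine norm_le_of_forall_mem_frontier_norm_le (f := fun t => u (t, y)) isBounded_ball
      (((h1 y (hbb w hy)).mono (closedBall_subset_ball hrR)).diffContOnCl_ball subset_rfl) ?_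
      (subset_closure ht)
    intro s hs
    rw [frontier_ball _ hr.ne'] at hs
    exact hM (s, y) ⟨hs, ball_subset_closedBall hy⟩
  have hslice : ∀ t ∈ ball z r, t ≠ z → DifferentiableOn ℂ (fun y => u (t, y)) (ball w r) := by
    intro t ht htz y hy
    exact (DifferentiableAt.comp y (hoff t (hbb z ht) htz y (hbb w hy))
      ((differentiableAt_const t).prodMk differentiableAt_id)).differentiableWithinAt
  have hz : z ∈ ball z r := mem_ball_self hr
  have hlip : ∀ t ∈ ball z r, ∀ y ∈ ball w r,
      dist (u (t, y)) (u (z, y)) ≤ 2 * M / r * dist t z := by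
    intro t ht y hy
    refine dist_le_div_mul_dist_of_mapsTo_ball (f := fun t => u (t, y))
      ((h1 y (hbb w hy)).mono (hbb z)) ?_ ht
    intro v hv
    rw [mem_closedBall, dist_eq_norm]
    linarith [norm_sub_le (u (v, y)) (u (z, y)), hbd v hv y hy, hbd z hz y hy]
  have hlim : DifferentiableOn ℂ (fun y => u (z, y)) (ball w r) := by
    have hunif : TendstoUniformlyOn (fun t y => u (t, y)) (fun y => u (z, y)) (𝓝[≠] z)
        (ball w r) := by
      rw [Metric.tendstoUniformlyOn_iff]
      intro ε hε
      have hc : Tendsto (fun t => 2 * M / r * dist t z) (𝓝[≠] z) (𝓝 0) := by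
        have : Continuous fun t : ℂ => 2 * M / r * dist t z := by fun_prop
        simpa using (this.tendsto z).mono_left nhdsWithin_le_nhds
      filter_upwards [hc.eventually_lt_const hε,
        nhdsWithin_le_nhds (ball_mem_nhds z hr)] with t ht htb y hy
      rw [dist_comm]
      exact (hlip t htb y hy).trans_lt ht
    refine hunif.tendstoLocallyUniformlyOn.differentiableOn ?_ isOpen_ball
    filter_upwards [nhdsWithin_le_nhds (ball_mem_nhds z hr), self_mem_nhdsWithin] with t ht htz
    exact hslice t ht htz
  refine differentiableAt_of_separately_of_bounded hr
    (fun y hy => (h1 y (hbb w hy)).mono (hbb z)) (fun t ht => ?_) hbd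
  by_cases htz : t = z
  · rw [htz]; exact hlim
  · exact hslice t ht htz

/-! ### Growth of products of linear factors -/

/-- `log ‖1 + w‖` agrees with `Re w` up to a quadratic error. -/
theorem abs_log_norm_one_add_sub_re_le {w : ℂ} (hw : ‖w‖ ≤ 1 / 2) :
    |Real.log ‖1 + w‖ - w.re| ≤ ‖w‖ ^ 2 := by
  have h1 : |Real.log ‖1 + w‖ - w.re| ≤ ‖log (1 + w) - w‖ := by
    have := abs_re_le_norm (log (1 + w) - w)
    rwa [sub_re, log_re] at this
  have h2 := norm_log_one_add_sub_self_le (z := w) (by linarith)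
  have h3 : (1 - ‖w‖)⁻¹ ≤ 2 := by
    rw [inv_le_comm₀ (by linarith) (by norm_num)]
    linarith
  nlinarith [sq_nonneg ‖w‖]

theorem natCast_add_ne_zero {R : ℝ} {p : ℂ} {n : ℕ} (hp : ‖p‖ ≤ R) (hR : 0 < R)
    (hn : 2 * R ≤ n) : (n : ℂ) + p ≠ 0 := by
  intro h
  have : ‖p‖ = n := by
    rw [eq_neg_of_add_eq_zero_right h, norm_neg, Complex.norm_natCast]
  linarith

theorem norm_natCast_add_le {R : ℝ} {p q : ℂ} {n : ℕ} (hp : ‖p‖ ≤ R) (hq : ‖q‖ ≤ R) (hR : 0 < R)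
    (hn : 2 * R ≤ n) :
    ‖(n : ℂ) + p‖ ≤ Real.exp ((p.re - q.re) / n + 2 * R ^ 2 / n ^ 2) * ‖(n : ℂ) + q‖ := by
  have hn0 : (0 : ℝ) < n := by linarith
  have hnC : (n : ℂ) ≠ 0 := by exact_mod_cast hn0.ne'
  have key : ∀ w : ℂ, ‖w‖ ≤ R → 0 < ‖(n : ℂ) + w‖ ∧
      |Real.log ‖(n : ℂ) + w‖ - Real.log n - w.re / n| ≤ R ^ 2 / n ^ 2 := by
    intro w hw
    have hpos : 0 < ‖(n : ℂ) + w‖ := norm_pos_iff.2 (natCast_add_ne_zero hw hR hn)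
    refine ⟨hpos, ?_⟩
    have hwn : ‖w / n‖ = ‖w‖ / n := by rw [norm_div, Complex.norm_natCast]
    have h1 : ‖w / n‖ ≤ 1 / 2 := by
      rw [hwn, div_le_iff₀ hn0]; linarith
    have h2 := abs_log_norm_one_add_sub_re_le h1
    have h3 : (1 : ℂ) + w / n = (n + w) / n := by field_simp
    have h4 : (w / n).re = w.re / n := by
      rw [← ofReal_natCast, div_ofReal_re]
    rw [h3, norm_div, Complex.norm_natCast, Real.log_div hpos.ne' hn0.ne', h4, hwn] at h2
    refine h2.trans ?_
    rw [div_pow]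
    gcongr
  obtain ⟨hp0, hp1⟩ := key p hp
  obtain ⟨hq0, hq1⟩ := key q hq
  rw [← Real.log_le_log_iff hp0 (by positivity), Real.log_mul (Real.exp_pos _).ne' hq0.ne',
    Real.log_exp]
  have := (abs_le.1 hp1).2
  have := (abs_le.1 hq1).1
  have e : (p.re - q.re) / n + 2 * R ^ 2 / n ^ 2 =
      p.re / n - q.re / n + (R ^ 2 / n ^ 2 + R ^ 2 / n ^ 2) := by ring
  rw [e]
  linarith

theorem norm_prod_natCast_add_le {ι : Type*} (s : Finset ι) {R : ℝ} {p q : ι → ℂ} {n : ℕ}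
    (hp : ∀ i ∈ s, ‖p i‖ ≤ R) (hq : ∀ i ∈ s, ‖q i‖ ≤ R) (hR : 0 < R) (hn : 2 * R ≤ n) :
    ‖∏ i ∈ s, ((n : ℂ) + p i)‖ ≤
      Real.exp ((∑ i ∈ s, (p i - q i)).re / n + s.card * (2 * R ^ 2) / n ^ 2) *
        ‖∏ i ∈ s, ((n : ℂ) + q i)‖ := by
  have e : (∑ i ∈ s, (p i - q i)).re / n + s.card * (2 * R ^ 2) / n ^ 2 =
      ∑ i ∈ s, (((p i).re - (q i).re) / n + 2 * R ^ 2 / n ^ 2) := by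
    rw [Finset.sum_add_distrib, Finset.sum_const, ← Finset.sum_div, re_sum, nsmul_eq_mul,
      mul_div_assoc]
    simp
  rw [e, Real.exp_sum, norm_prod, norm_prod, ← Finset.prod_mul_distrib]
  exact Finset.prod_le_prod (fun _ _ => norm_nonneg _)
    fun i hi => norm_natCast_add_le (hp i hi) (hq i hi) hR hn

/-! ### Well-poised sequences -/

/-- The numerator of the term ratio of a well-poised series with parameters `α; b, c`. -/
def wpNum (α b : ℂ) (c : Fin 4 → ℂ) (n : ℕ) : ℂ := (α + n) * (b + n) * ∏ i, (c i + n)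

/-- The denominator of the term ratio of a well-poised series with parameters `α; b, c`. -/
def wpDen (α b : ℂ) (c : Fin 4 → ℂ) (n : ℕ) : ℂ :=
  (n + 1) * (1 + α - b + n) * ∏ i, (1 + α - c i + n)

/-- `h` satisfies, from the index `n₀` on, the first-order recurrence of the terms of the
well-poised `₆F₅`-series of argument `1` with upper parameters `α, b, c 0, …, c 3`. The
very-well-poised terms are `(α + 2 n) h n`. -/
def IsWellPoised (α b : ℂ) (c : Fin 4 → ℂ) (n₀ : ℕ) (h : ℕ → ℂ) : Prop :=
  ∀ n, n₀ ≤ n → h (n + 1) * wpDen α b c n = h n * wpNum α b c n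

/-- Half of the parametric excess of the very-well-poised `₇F₆`-series with parameters `α; b, c`:
its terms decay like `n ^ (-1 - 2σ)`. -/
def wpExcess (α b : ℂ) (c : Fin 4 → ℂ) : ℂ := 2 + 2 * α - b - ∑ i, c i

/-- The term ratio of a very-well-poised series, compared with that of `n ^ (-1 - ρ)`, uniformly
for bounded parameters. -/
theorem exists_norm_wpNum_mul_rpow_le (R : ℝ) {ρ ε : ℝ} (hρ : 0 ≤ ρ) (hε : 0 < ε) :
    ∃ n₁ : ℕ, 1 ≤ n₁ ∧ ∀ (α b : ℂ) (c : Fin 4 → ℂ), ‖α‖ ≤ R → ‖b‖ ≤ R → (∀ i, ‖c i‖ ≤ R) →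
      ρ + ε ≤ 2 * (wpExcess α b c).re → ∀ n : ℕ, n₁ ≤ n →
        (α + 2 * n) * wpDen α b c n ≠ 0 ∧
        ‖(α + 2 * (n + 1)) * wpNum α b c n‖ * ((n : ℝ) + 1) ^ (1 + ρ) ≤
          ‖(α + 2 * n) * wpDen α b c n‖ * (n : ℝ) ^ (1 + ρ) := by
  set S : ℝ := 2 * |R| + 2 with hS
  have hS0 : 0 < S := by positivity
  obtain ⟨n₁, hn₁⟩ := exists_nat_ge (max (2 * S) (7 * (2 * S ^ 2) / ε))
  refine ⟨max n₁ 1, le_max_right _ _, fun α b c hα hb hc hσ n hn => ?_⟩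
  have hn1 : (n₁ : ℝ) ≤ n := by exact_mod_cast (le_max_left _ _).trans hn
  have hn0 : (1 : ℝ) ≤ n := by exact_mod_cast (le_max_right _ _).trans hn
  have hnpos : (0 : ℝ) < n := by linarith
  have hnS : 2 * S ≤ n := (le_max_left _ _).trans (hn₁.trans hn1)
  have hnε : 7 * (2 * S ^ 2) / ε ≤ n := (le_max_right _ _).trans (hn₁.trans hn1)
  have hRR := le_abs_self R
  have hR0 := abs_nonneg R
  have hsub : ∀ x : ℂ, ‖x‖ ≤ R → ‖1 + α - x‖ ≤ S := by
    intro x hx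
    have h1 := norm_sub_le (1 + α) x
    have h2 := norm_add_le 1 α
    rw [norm_one] at h2
    linarith
  have hself : ∀ x : ℂ, ‖x‖ ≤ R → ‖x‖ ≤ S := fun x hx => by linarith
  have hhalf : ‖α / 2‖ ≤ R := by
    rw [norm_div, RCLike.norm_ofNat]; linarith [norm_nonneg α]
  have hhalf1 : ‖α / 2 + 1‖ ≤ S := by
    have := norm_add_le (α / 2) 1
    rw [norm_one] at this
    linarith
  set p : Fin 7 → ℂ := ![α / 2 + 1, α, b, c 0, c 1, c 2, c 3] with hp
  set q : Fin 7 → ℂ :=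
    ![α / 2, 1, 1 + α - b, 1 + α - c 0, 1 + α - c 1, 1 + α - c 2, 1 + α - c 3] with hq
  have hpS : ∀ i ∈ Finset.univ, ‖p i‖ ≤ S := by
    intro i _
    fin_cases i
    exacts [hhalf1, hself _ hα, hself _ hb, hself _ (hc 0), hself _ (hc 1), hself _ (hc 2),
      hself _ (hc 3)]
  have hqS : ∀ i ∈ Finset.univ, ‖q i‖ ≤ S := by
    intro i _
    fin_cases i
    exacts [hself _ hhalf, show ‖(1 : ℂ)‖ ≤ S by rw [norm_one]; linarith, hsub _ hb, hsub _ (hc 0),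
      hsub _ (hc 1), hsub _ (hc 2), hsub _ (hc 3)]
  have hmain := norm_prod_natCast_add_le Finset.univ hpS hqS hS0 hnS
  have hP : (α + 2 * (n + 1)) * wpNum α b c n = 2 * ∏ i, ((n : ℂ) + p i) := by
    simp only [hp, wpNum, Fin.prod_univ_succ, Fin.prod_univ_zero]
    simp
    ring
  have hQ : (α + 2 * n) * wpDen α b c n = 2 * ∏ i, ((n : ℂ) + q i) := by
    simp only [hq, wpDen, Fin.prod_univ_succ, Fin.prod_univ_zero]
    simp
    ring
  have hsum : ∑ i, (p i - q i) = -(1 + 2 * wpExcess α b c) := by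
    simp only [hp, hq, wpExcess, Fin.sum_univ_succ, Fin.sum_univ_zero]
    simp
    ring
  refine ⟨?_, ?_⟩
  · rw [hQ]
    exact mul_ne_zero two_ne_zero (Finset.prod_ne_zero_iff.2 fun i hi =>
      natCast_add_ne_zero (hqS i hi) hS0 hnS)
  · have hexp : Real.exp ((∑ i, (p i - q i)).re / n +
        (Finset.univ : Finset (Fin 7)).card * (2 * S ^ 2) / n ^ 2) ≤
        Real.exp (-(1 + ρ) / n) := by
      rw [Real.exp_le_exp, hsum]
      have h1 : ((Finset.univ : Finset (Fin 7)).card : ℝ) * (2 * S ^ 2) / n ^ 2 ≤ ε / n := by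
        rw [Finset.card_univ, Fintype.card_fin, sq (n : ℝ), ← div_div]
        gcongr
        rw [div_le_iff₀ hnpos]
        rw [div_le_iff₀ hε] at hnε
        push_cast
        linarith
      have h2 : (-(1 + 2 * wpExcess α b c)).re / n ≤ -(1 + ρ + ε) / n := by
        gcongr
        simp only [neg_re, add_re, one_re, mul_re, re_ofNat, im_ofNat]
        linarith
      calc _ ≤ -(1 + ρ + ε) / n + ε / n := add_le_add h2 h1
        _ = _ := by ring
    have hpow : Real.exp (-(1 + ρ) / n) * ((n : ℝ) + 1) ^ (1 + ρ) ≤ (n : ℝ) ^ (1 + ρ) := by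
      have h1 : (n : ℝ) + 1 ≤ n * Real.exp (1 / n) := by
        have := Real.add_one_le_exp (1 / (n : ℝ))
        calc (n : ℝ) + 1 = n * (1 / n + 1) := by field_simp; ring
          _ ≤ _ := by gcongr
      calc Real.exp (-(1 + ρ) / n) * ((n : ℝ) + 1) ^ (1 + ρ)
          ≤ Real.exp (-(1 + ρ) / n) * (n * Real.exp (1 / n)) ^ (1 + ρ) := by gcongr
        _ = (n : ℝ) ^ (1 + ρ) := by
          rw [Real.mul_rpow hnpos.le (Real.exp_pos _).le, ← Real.exp_mul, mul_left_comm,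
            ← Real.exp_add]
          have : -(1 + ρ) / n + 1 / n * (1 + ρ) = 0 := by ring
          rw [this, Real.exp_zero, mul_one]
    rw [hP, hQ, norm_mul, norm_mul, mul_assoc, mul_assoc]
    refine mul_le_mul_of_nonneg_left ?_ (norm_nonneg _)
    calc ‖∏ i, ((n : ℂ) + p i)‖ * ((n : ℝ) + 1) ^ (1 + ρ)
        ≤ (Real.exp (-(1 + ρ) / n) * ‖∏ i, ((n : ℂ) + q i)‖) * ((n : ℝ) + 1) ^ (1 + ρ) := by
          gcongr
          exact hmain.trans (by gcongr)
      _ = ‖∏ i, ((n : ℂ) + q i)‖ * (Real.exp (-(1 + ρ) / n) * ((n : ℝ) + 1) ^ (1 + ρ)) := by ring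
      _ ≤ _ := by gcongr

/-- The terms of a very-well-poised series decay at least like `n ^ (-1 - ρ)` if `ρ` is less than
twice the excess, uniformly for bounded parameters. -/
theorem exists_norm_wellPoised_le (R : ℝ) {ρ ε : ℝ} (hρ : 0 ≤ ρ) (hε : 0 < ε) (n₀ : ℕ) :
    ∃ n₁ : ℕ, n₀ ≤ n₁ ∧ 1 ≤ n₁ ∧ ∀ (α b : ℂ) (c : Fin 4 → ℂ), ‖α‖ ≤ R → ‖b‖ ≤ R →
      (∀ i, ‖c i‖ ≤ R) → ρ + ε ≤ 2 * (wpExcess α b c).re →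
        ∀ h, IsWellPoised α b c n₀ h → ∀ n : ℕ, n₁ ≤ n →
          ‖(α + 2 * n) * h n‖ ≤
            ‖(α + 2 * n₁) * h n₁‖ * (n₁ : ℝ) ^ (1 + ρ) * ((n : ℝ) ^ (1 + ρ))⁻¹ := by
  obtain ⟨m, hm1, hm⟩ := exists_norm_wpNum_mul_rpow_le R hρ hε
  refine ⟨max n₀ m, le_max_left _ _, hm1.trans (le_max_right _ _),
    fun α b c hα hb hc hσ h hh n hn => ?_⟩
  have hnpos : ∀ n, max n₀ m ≤ n → (0 : ℝ) < n := fun n hn => by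
    exact_mod_cast (hm1.trans (le_max_right _ _)).trans hn
  rw [← div_eq_mul_inv, le_div_iff₀ (Real.rpow_pos_of_pos (hnpos n hn) _)]
  induction n, hn using Nat.le_induction with
  | base => exact le_rfl
  | succ n hn ih =>
    refine le_trans ?_ ih
    obtain ⟨hne, hle⟩ := hm α b c hα hb hc hσ n ((le_max_right _ _).trans hn)
    have hrec := hh n ((le_max_left _ _).trans hn)
    have hmul : ((α + 2 * (n + 1 : ℕ)) * h (n + 1)) * ((α + 2 * n) * wpDen α b c n) =
        ((α + 2 * n) * h n) * ((α + 2 * (n + 1)) * wpNum α b c n) := by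
      push_cast
      linear_combination (α + 2 * (n + 1)) * (α + 2 * n) * hrec
    have hpos : 0 < ‖(α + 2 * n) * wpDen α b c n‖ := norm_pos_iff.2 hne
    refine le_of_mul_le_mul_right ?_ hpos
    rw [mul_right_comm, ← norm_mul, hmul, norm_mul, mul_assoc]
    push_cast
    calc _ ≤ ‖(α + 2 * n) * h n‖ * (‖(α + 2 * n) * wpDen α b c n‖ * (n : ℝ) ^ (1 + ρ)) := by
          gcongr
      _ = _ := by ring

theorem summable_wellPoised {α b : ℂ} {c : Fin 4 → ℂ} {n₀ : ℕ} {h : ℕ → ℂ}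
    (hh : IsWellPoised α b c n₀ h) (hσ : 0 < (wpExcess α b c).re) :
    Summable fun n : ℕ => (α + 2 * n) * h n := by
  set R := ‖α‖ + ‖b‖ + ∑ i, ‖c i‖
  have hc0 : ∀ i, ‖c i‖ ≤ ∑ i, ‖c i‖ := fun i =>
    Finset.single_le_sum (f := fun i => ‖c i‖) (fun _ _ => norm_nonneg _) (Finset.mem_univ i)
  have hs0 : 0 ≤ ∑ i, ‖c i‖ := Finset.sum_nonneg fun _ _ => norm_nonneg _
  have ha := norm_nonneg α
  have hb := norm_nonneg b
  obtain ⟨n₁, -, -, hn₁⟩ := exists_norm_wellPoised_le R hσ.le hσ n₀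
  have hle := hn₁ α b c (by linarith) (by linarith) (fun i => by linarith [hc0 i])
    (by linarith) h hh
  refine Summable.of_norm_bounded_eventually_nat
    (g := fun n : ℕ => ‖(α + 2 * n₁) * h n₁‖ * (n₁ : ℝ) ^ (1 + (wpExcess α b c).re) *
      ((n : ℝ) ^ (1 + (wpExcess α b c).re))⁻¹) ?_ ?_
  · exact (Real.summable_nat_rpow_inv.2 (by linarith)).mul_left _
  · filter_upwards [eventually_ge_atTop n₁] with n hn using hle n hn

/-! ### Telescoping -/

/-- The denominator of the term ratio of a well-poised series, shifted by one: the product of the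
factors `n + α / 2 - u` where `wpNum` has the factors `n + α / 2 + u`. -/
def wpLow (α b : ℂ) (c : Fin 4 → ℂ) (n : ℕ) : ℂ := n * (α - b + n) * ∏ i, (α - c i + n)

theorem IsWellPoised.mul_wpLow_succ {α b : ℂ} {c : Fin 4 → ℂ} {n₀ : ℕ} {h : ℕ → ℂ}
    (hh : IsWellPoised α b c n₀ h) {n : ℕ} (hn : n₀ ≤ n) :
    h (n + 1) * wpLow α b c (n + 1) = h n * wpNum α b c n := by
  rw [← hh n hn]
  simp only [wpLow, wpDen, Fin.prod_univ_four]
  push_cast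
  ring

theorem norm_wpLow_le {α b : ℂ} {c : Fin 4 → ℂ} {n : ℕ} {R : ℝ} (hα : ‖α‖ ≤ R) (hb : ‖b‖ ≤ R)
    (hc : ∀ i, ‖c i‖ ≤ R) (hn : 2 * R ≤ n) : ‖wpLow α b c n‖ ≤ n * (2 * n) ^ 5 := by
  have key : ∀ x : ℂ, ‖x‖ ≤ R → ‖α - x + n‖ ≤ 2 * n := by
    intro x hx
    have h1 := norm_add_le (α - x) n
    have h2 := norm_sub_le α x
    rw [Complex.norm_natCast] at h1
    linarith
  rw [wpLow, norm_mul, norm_mul, Complex.norm_natCast, mul_assoc]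
  refine mul_le_mul_of_nonneg_left ?_ (Nat.cast_nonneg n)
  rw [norm_prod, Fin.prod_univ_four, pow_succ' _ 4]
  refine mul_le_mul (key b hb) ?_ (by positivity) (by positivity)
  calc _ ≤ (2 * n) * (2 * n) * (2 * n) * (2 * (n : ℝ)) := by
        gcongr <;> exact key _ (hc _)
    _ = _ := by ring

/-- The telescoping quantity tends to zero as soon as the excess is larger than `2`. -/
theorem IsWellPoised.tendsto_mul_wpLow {α b : ℂ} {c : Fin 4 → ℂ} {n₀ : ℕ} {h : ℕ → ℂ}
    (hh : IsWellPoised α b c n₀ h) (hσ : 2 < (wpExcess α b c).re) :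
    Tendsto (fun n => h n * wpLow α b c n) atTop (𝓝 0) := by
  set R := ‖α‖ + ‖b‖ + ∑ i, ‖c i‖
  have hc0 : ∀ i, ‖c i‖ ≤ ∑ i, ‖c i‖ := fun i =>
    Finset.single_le_sum (f := fun i => ‖c i‖) (fun _ _ => norm_nonneg _) (Finset.mem_univ i)
  have hs0 : 0 ≤ ∑ i, ‖c i‖ := Finset.sum_nonneg fun _ _ => norm_nonneg _
  have ha := norm_nonneg α
  have hb := norm_nonneg b
  have haR : ‖α‖ ≤ R := by linarith
  have hbR : ‖b‖ ≤ R := by linarith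
  have hcR : ∀ i, ‖c i‖ ≤ R := fun i => by linarith [hc0 i]
  set ε := 2 * (wpExcess α b c).re - 4 with hε_def
  have hε : 0 < ε := by linarith
  -- `ρ = 4 + ε / 2`: one power of `n` more than the degree of the telescoping factor needs
  obtain ⟨n₁, -, hn1, hn₁⟩ := exists_norm_wellPoised_le R (ρ := 4 + ε / 2) (ε := ε / 2)
    (by positivity) (by positivity) n₀
  have hle := hn₁ α b c haR hbR hcR (by linarith) h hh
  set K := ‖(α + 2 * n₁) * h n₁‖ * (n₁ : ℝ) ^ (1 + (4 + ε / 2))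
  have hlim : Tendsto (fun n : ℕ => 32 * K * (n : ℝ) ^ (-(ε / 2))) atTop (𝓝 0) := by
    have := ((tendsto_rpow_neg_atTop (half_pos hε)).comp tendsto_natCast_atTop_atTop).const_mul
      (32 * K)
    simpa using this
  refine squeeze_zero_norm' ?_ hlim
  obtain ⟨n₂, hn₂⟩ := exists_nat_ge (2 * R)
  filter_upwards [eventually_ge_atTop n₁, eventually_ge_atTop n₂] with n hna hnb
  have hnR : 2 * R ≤ n := hn₂.trans (by exact_mod_cast hnb)
  have hn0 : (0 : ℝ) < n := by exact_mod_cast hn1.trans hna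
  have hlow := norm_wpLow_le haR hbR hcR hnR
  have hT := hle n hna
  have hα2 : (n : ℝ) ≤ ‖α + 2 * n‖ := by
    have h1 := norm_sub_norm_le (2 * (n : ℂ)) (-α)
    rw [norm_neg, norm_mul, Complex.norm_natCast, RCLike.norm_ofNat, sub_neg_eq_add,
      add_comm (2 * (n : ℂ))] at h1
    linarith
  have hnh : n * ‖h n‖ ≤ K * ((n : ℝ) ^ (1 + (4 + ε / 2)))⁻¹ := by
    refine le_trans ?_ hT
    rw [norm_mul]
    gcongr
  calc ‖h n * wpLow α b c n‖ ≤ ‖h n‖ * (n * (2 * n) ^ 5) := by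
        rw [norm_mul]; gcongr
    _ = (n * ‖h n‖) * (32 * (n : ℝ) ^ 5) := by ring
    _ ≤ (K * ((n : ℝ) ^ (1 + (4 + ε / 2)))⁻¹) * (32 * (n : ℝ) ^ 5) := by gcongr
    _ = 32 * K * (n : ℝ) ^ (-(ε / 2)) := by
      have : (n : ℝ) ^ (1 + (4 + ε / 2)) = (n : ℝ) ^ 5 * (n : ℝ) ^ (ε / 2) := by
        rw [← Real.rpow_natCast, ← Real.rpow_add hn0]
        congr 1
        push_cast
        ring
      rw [this, Real.rpow_neg hn0.le]
      field_simp

theorem IsWellPoised.tsum_telescope {α b : ℂ} {c : Fin 4 → ℂ} {n₀ n₁ : ℕ} {h : ℕ → ℂ}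
    (hh : IsWellPoised α b c n₀ h) (hσ : 2 < (wpExcess α b c).re) (hn : n₀ ≤ n₁)
    (hs : Summable fun k => h (k + n₁) * (wpNum α b c (k + n₁) - wpLow α b c (k + n₁))) :
    ∑' k, h (k + n₁) * (wpNum α b c (k + n₁) - wpLow α b c (k + n₁)) =
      -(h n₁ * wpLow α b c n₁) := by
  refine tendsto_nhds_unique hs.hasSum.tendsto_sum_nat ?_
  have hpart : ∀ N : ℕ, ∑ k ∈ Finset.range N,
      h (k + n₁) * (wpNum α b c (k + n₁) - wpLow α b c (k + n₁)) =
      h (N + n₁) * wpLow α b c (N + n₁) - h n₁ * wpLow α b c n₁ := by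
    intro N
    have := Finset.sum_range_sub (fun k => h (k + n₁) * wpLow α b c (k + n₁)) N
    rw [zero_add] at this
    rw [← this]
    refine Finset.sum_congr rfl fun k _ => ?_
    rw [mul_sub, ← hh.mul_wpLow_succ (hn.trans (Nat.le_add_left n₁ k))]
    congr 2 <;> ring_nf
  simp_rw [hpart]
  have := ((tendsto_add_atTop_iff_nat n₁).2 (hh.tendsto_mul_wpLow hσ)).sub_const
    (h n₁ * wpLow α b c n₁)
  simpa using this

/-! ### The regularised terms and their lowered variants -/

/-- The terms of the regularised well-poised series with upper parameters `α, b, c 0, …, c 3`, in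
which `b` has been lowered to `b - j`. The lower parameters enter through the entire function
`1 / Γ`, and `(b - j)ₙ` is normalised to `(b)ₙ₋ⱼ`, so that for `j ≤ n` the terms are entire in all
parameters and related by multiplication with polynomials. For `n < j` the subtraction truncates, and
the value has no meaning; the relations between lowered terms are only used for `j ≤ n`. -/
noncomputable def wpSeq (α b : ℂ) (c : Fin 4 → ℂ) (j n : ℕ) : ℂ :=
  (ascPochhammer ℂ n).eval α * (ascPochhammer ℂ (n - j)).eval b *
      (∏ i, (ascPochhammer ℂ n).eval (c i)) / n.factorial *
    ((Gamma (1 + α - b + j + n))⁻¹ * ∏ i, (Gamma (1 + α - c i + n))⁻¹)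

theorem isWellPoised_wpSeq (α b : ℂ) (c : Fin 4 → ℂ) (j : ℕ) :
    IsWellPoised α (b - j) c j (wpSeq α b c j) := by
  intro n hn
  have hg : ∀ z : ℂ, (Gamma (z + n))⁻¹ = (z + n) * (Gamma (z + (n + 1 : ℕ)))⁻¹ := by
    intro z
    rw [one_div_Gamma_eq_self_mul_one_div_Gamma_add_one]
    push_cast
    rw [add_assoc]
  have hf : ((n.factorial : ℕ) : ℂ)⁻¹ = (n + 1) * (((n + 1).factorial : ℕ) : ℂ)⁻¹ := by
    have hn0 : (n : ℂ) + 1 ≠ 0 := by exact_mod_cast n.succ_ne_zero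
    rw [Nat.factorial_succ]
    push_cast
    rw [mul_inv, mul_inv_cancel_left₀ hn0]
  have hs : n + 1 - j = n - j + 1 := by omega
  simp only [wpSeq, wpNum, wpDen, Fin.prod_univ_four, hs, div_eq_mul_inv,
    ascPochhammer_succ_eval, Nat.cast_sub hn, hf]
  rw [hg (1 + α - b + j), hg (1 + α - c 0), hg (1 + α - c 1), hg (1 + α - c 2), hg (1 + α - c 3)]
  generalize (Gamma (1 + α - b + j + (n + 1 : ℕ)))⁻¹ = g
  generalize (Gamma (1 + α - c 0 + (n + 1 : ℕ)))⁻¹ = g₀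
  generalize (Gamma (1 + α - c 1 + (n + 1 : ℕ)))⁻¹ = g₁
  generalize (Gamma (1 + α - c 2 + (n + 1 : ℕ)))⁻¹ = g₂
  generalize (Gamma (1 + α - c 3 + (n + 1 : ℕ)))⁻¹ = g₃
  generalize (((n + 1).factorial : ℕ) : ℂ)⁻¹ = f
  have e₁ : 1 + α - (b - j) + n = 1 + α - b + j + n := by ring
  have e₂ : b - j + n = b + (n - j) := by ring
  rw [e₁, e₂]
  -- the linear factors are kept as atoms, since multiplying them out is expensive
  generalize 1 + α - b + j + (n : ℂ) = l
  generalize 1 + α - c 0 + (n : ℂ) = l₀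
  generalize 1 + α - c 1 + (n : ℂ) = l₁
  generalize 1 + α - c 2 + (n : ℂ) = l₂
  generalize 1 + α - c 3 + (n : ℂ) = l₃
  generalize (n : ℂ) + 1 = l₄
  generalize α + (n : ℂ) = a
  generalize b + ((n : ℂ) - j) = b'
  generalize c 0 + (n : ℂ) = c₀
  generalize c 1 + (n : ℂ) = c₁
  generalize c 2 + (n : ℂ) = c₂
  generalize c 3 + (n : ℂ) = c₃
  generalize (ascPochhammer ℂ n).eval α = p
  generalize (ascPochhammer ℂ (n - j)).eval b = q
  ring

theorem wpSeq_eq_wpSeq_succ_mul (α b : ℂ) (c : Fin 4 → ℂ) {j n : ℕ} (hn : j + 1 ≤ n) :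
    wpSeq α b c j n =
      wpSeq α b c (j + 1) n * ((b - (j + 1) + n) * (1 + α - b + j + n)) := by
  obtain ⟨m, rfl⟩ := Nat.exists_eq_add_of_le hn
  have h1 : j + 1 + m - j = m + 1 := by omega
  have h2 : j + 1 + m - (j + 1) = m := by omega
  have h3 : (Gamma (1 + α - b + j + (j + 1 + m : ℕ)))⁻¹ = (1 + α - b + j + (j + 1 + m : ℕ)) *
      (Gamma (1 + α - b + (j + 1 : ℕ) + (j + 1 + m : ℕ)))⁻¹ := by
    rw [one_div_Gamma_eq_self_mul_one_div_Gamma_add_one]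
    push_cast
    ring_nf
  simp only [wpSeq, h1, h2, h3, ascPochhammer_succ_eval]
  push_cast
  ring

theorem wpSeq_neg_natCast (m : ℕ) (b : ℂ) (c : Fin 4 → ℂ) (j : ℕ) {n : ℕ} (hn : m < n) :
    wpSeq (-m) b c j n = 0 := by
  rw [wpSeq, ascPochhammer_eval_neg_eq_descPochhammer, descPochhammer_eval_eq_descFactorial,
    Nat.descFactorial_of_lt hn]
  simp

theorem inv_Gamma_one_sub_sub_natCast (b : ℂ) (k : ℕ) :
    (Gamma (1 - b - k))⁻¹ = (-1) ^ k * (ascPochhammer ℂ k).eval b * (Gamma (1 - b))⁻¹ := by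
  induction k with
  | zero => simp
  | succ k ih =>
    rw [one_div_Gamma_eq_self_mul_one_div_Gamma_add_one]
    have : 1 - b - (k + 1 : ℕ) + 1 = 1 - b - k := by push_cast; ring
    rw [this, ih, ascPochhammer_succ_eval]
    push_cast
    ring

/-- For `α = -m` the finitely many nonzero terms cancel in pairs under `n ↦ m - n`. -/
theorem sum_wpSeq_neg_natCast (m : ℕ) (b : ℂ) (c : Fin 4 → ℂ) {n₀ : ℕ} (hm : m < n₀) :
    ∑ n ∈ Finset.range n₀, (-m + 2 * n : ℂ) * wpSeq (-m) b c 0 n = 0 := by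
  set g : ℂ → ℕ → ℂ := fun x n =>
    (ascPochhammer ℂ n).eval x * (ascPochhammer ℂ (m - n)).eval x * (Gamma (1 - x))⁻¹ with hg_def
  set s : ℕ → ℂ := fun n => (m.choose n : ℂ) * (g b n * ∏ i, g (c i) n) with hs_def
  have hgamma : ∀ x : ℂ, ∀ n ≤ m,
      (ascPochhammer ℂ n).eval x * (Gamma (1 + (-m : ℂ) - x + n))⁻¹ = (-1) ^ (m - n) * g x n := by
    intro x n hn
    have : 1 + (-m : ℂ) - x + n = 1 - x - (m - n : ℕ) := by rw [Nat.cast_sub hn]; ring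
    rw [this, inv_Gamma_one_sub_sub_natCast, hg_def]
    ring
  have hterm : ∀ n ≤ m, wpSeq (-m) b c 0 n = (-1) ^ m * s n := by
    intro n hn
    have hpow : ((-1 : ℂ)) ^ n * ((-1) ^ (m - n)) ^ 5 = (-1) ^ m := by
      have h4 : (((-1 : ℂ)) ^ (m - n)) ^ 4 = 1 := by
        rw [← pow_mul, mul_comm, pow_mul]; norm_num
      rw [pow_succ _ 4, h4, one_mul, ← pow_add]
      congr 1
      omega
    have hchoose : (m.descFactorial n : ℂ) = n.factorial * m.choose n := by
      rw [Nat.descFactorial_eq_factorial_mul_choose]; push_cast; rfl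
    have hf0 : (n.factorial : ℂ) ≠ 0 := by exact_mod_cast n.factorial_ne_zero
    have hb := hgamma b n hn
    have hc := fun i => hgamma (c i) n hn
    rw [wpSeq, ascPochhammer_eval_neg_eq_descPochhammer, descPochhammer_eval_eq_descFactorial,
      hchoose, ← hpow]
    simp only [Nat.sub_zero, Nat.cast_zero, add_zero, hs_def]
    calc _ = (-1) ^ n * (m.choose n : ℂ) *
          (((ascPochhammer ℂ n).eval b * (Gamma (1 + (-m : ℂ) - b + n))⁻¹) *
            ∏ i, ((ascPochhammer ℂ n).eval (c i) * (Gamma (1 + (-m : ℂ) - c i + n))⁻¹)) := by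
          rw [Finset.prod_mul_distrib]
          field_simp
      _ = _ := by
        simp only [hb, hc, Fin.prod_univ_four]
        ring
  have hsymm : ∀ n ≤ m, s (m - n) = s n := by
    intro n hn
    simp only [hs_def, hg_def, Nat.choose_symm hn, Nat.sub_sub_self hn, Fin.prod_univ_four]
    ring
  rw [← Finset.sum_subset (Finset.range_subset_range.2 (Nat.succ_le_of_lt hm)) fun n _ hn => by
    rw [wpSeq_neg_natCast m b c 0 (by simpa [Nat.lt_succ_iff] using hn), mul_zero]]
  have hrefl := Finset.sum_range_reflect (fun n : ℕ => (-m + 2 * n : ℂ) * wpSeq (-m) b c 0 n) (m + 1)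
  have hneg : ∑ n ∈ Finset.range (m + 1), (-m + 2 * ((m + 1 - 1 - n : ℕ) : ℂ)) *
      wpSeq (-m) b c 0 (m + 1 - 1 - n) =
      -∑ n ∈ Finset.range (m + 1), (-m + 2 * n : ℂ) * wpSeq (-m) b c 0 n := by
    rw [← Finset.sum_neg_distrib]
    refine Finset.sum_congr rfl fun n hn => ?_
    have hn : n ≤ m := Nat.lt_succ_iff.1 (Finset.mem_range.1 hn)
    rw [Nat.add_sub_cancel, hterm _ (Nat.sub_le m n), hterm n hn, hsymm n hn, Nat.cast_sub hn]
    ring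
  rw [hneg] at hrefl
  exact self_eq_neg.1 hrefl.symm

/-! ### Analytic continuation in the excess -/

/-- The coefficient of the series lowered once, in the recurrence between lowered series. Here `b` is
the parameter lowered twice; the recurrence is even in `n + α / 2`, and `b - α / 2` and the
`c i - α / 2` are the parameters that enter with this variable. -/
noncomputable def wpCoeffOne (α b : ℂ) (c : Fin 4 → ℂ) : ℂ :=
  -((2 - wpExcess α b c) * ((b - α / 2 + 1) ^ 2 + (b - α / 2) ^ 2) +
    (((c 0 - α / 2) * (c 1 - α / 2) * (c 2 - α / 2) + (c 0 - α / 2) * (c 1 - α / 2) * (c 3 - α / 2) +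
      (c 0 - α / 2) * (c 2 - α / 2) * (c 3 - α / 2) + (c 1 - α / 2) * (c 2 - α / 2) * (c 3 - α / 2)) +
    b * ((c 0 - α / 2) * (c 1 - α / 2) + (c 0 - α / 2) * (c 2 - α / 2) +
      (c 0 - α / 2) * (c 3 - α / 2) + (c 1 - α / 2) * (c 2 - α / 2) +
      (c 1 - α / 2) * (c 3 - α / 2) + (c 2 - α / 2) * (c 3 - α / 2)) +
    α / 2 * (b - α / 2) * (∑ i, (c i - α / 2))))

/-- The coefficient of the series lowered twice, in the recurrence between lowered series. -/
def wpCoeffTwo (α b : ℂ) (c : Fin 4 → ℂ) : ℂ := -(b * ∏ i, (b + c i - α))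

theorem wpNum_sub_wpLow (α b : ℂ) (c : Fin 4 → ℂ) (n : ℕ) :
    wpNum α b c n - wpLow α b c n =
      (α + 2 * n) * ((2 - wpExcess α b c) * ((b + n) * (α - b + n) * ((b + 1 + n) * (α - b - 1 + n))) -
        (wpCoeffOne α b c * ((b + n) * (α - b + n)) + wpCoeffTwo α b c)) := by
  simp only [wpNum, wpLow, wpExcess, wpCoeffOne, wpCoeffTwo, Fin.prod_univ_four, Fin.sum_univ_four]
  ring

/-- The tail, from the index `n₀` on, of the very-well-poised series with `b` lowered to `b - j`. -/
noncomputable def wpTail (α b : ℂ) (c : Fin 4 → ℂ) (n₀ j : ℕ) : ℂ :=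
  ∑' k : ℕ, (α + 2 * (k + n₀ : ℕ)) * wpSeq α b c j (k + n₀)

/-- The `K`-fold iterate of the recurrence between lowered series, applied to the tail of the
very-well-poised series divided by `Γ` of its excess. Each iteration extends the half-plane on which
the expression is holomorphic by one unit of the excess. -/
noncomputable def wpContTail (α b : ℂ) (c : Fin 4 → ℂ) (n₀ : ℕ) : ℕ → ℕ → ℂ
  | 0, j => (Gamma (wpExcess α (b - j) c))⁻¹ * wpTail α b c n₀ j
  | K + 1, j =>
    (Gamma (wpExcess α (b - j) c + 1))⁻¹ *
        (wpSeq α b c (j + 2) n₀ * wpLow α (b - (j + 2 : ℕ)) c n₀) -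
      wpCoeffOne α (b - (j + 2 : ℕ)) c * wpContTail α b c n₀ K (j + 1) -
      wpCoeffTwo α (b - (j + 2 : ℕ)) c * (wpExcess α (b - j) c + 1) *
        wpContTail α b c n₀ K (j + 2)

theorem wpExcess_sub_natCast (α b : ℂ) (c : Fin 4 → ℂ) (j : ℕ) :
    wpExcess α (b - j) c = wpExcess α b c + j := by
  simp only [wpExcess]; ring

theorem summable_wpSeq {α b : ℂ} {c : Fin 4 → ℂ} {j : ℕ} (hσ : 0 < (wpExcess α (b - j) c).re)
    (n₀ : ℕ) : Summable fun k : ℕ => (α + 2 * (k + n₀ : ℕ)) * wpSeq α b c j (k + n₀) :=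
  (summable_nat_add_iff n₀).2 (summable_wellPoised (isWellPoised_wpSeq α b c j) hσ)

theorem wpExcess_mul_wpTail {α b : ℂ} {c : Fin 4 → ℂ} {j n₀ : ℕ}
    (hσ : 0 < (wpExcess α (b - j) c).re) (hn : j + 2 ≤ n₀) :
    wpExcess α (b - j) c * wpTail α b c n₀ j =
      wpSeq α b c (j + 2) n₀ * wpLow α (b - (j + 2 : ℕ)) c n₀ -
        wpCoeffOne α (b - (j + 2 : ℕ)) c * wpTail α b c n₀ (j + 1) -
        wpCoeffTwo α (b - (j + 2 : ℕ)) c * wpTail α b c n₀ (j + 2) := by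
  have e1 : wpExcess α (b - (j + 1 : ℕ)) c = wpExcess α (b - j) c + 1 := by
    simp only [wpExcess_sub_natCast]; push_cast; ring
  have e2 : wpExcess α (b - (j + 2 : ℕ)) c = wpExcess α (b - j) c + 2 := by
    simp only [wpExcess_sub_natCast]; push_cast; ring
  have hσ1 : 0 < (wpExcess α (b - (j + 1 : ℕ)) c).re := by
    rw [e1, add_re, one_re]; linarith
  have hσ2 : 2 < (wpExcess α (b - (j + 2 : ℕ)) c).re := by
    rw [e2, add_re, re_ofNat]; linarith
  have hs0 := summable_wpSeq hσ n₀
  have hs1 := summable_wpSeq hσ1 n₀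
  have hs2 := summable_wpSeq (by linarith : 0 < (wpExcess α (b - (j + 2 : ℕ)) c).re) n₀
  have hterm : ∀ k : ℕ, wpSeq α b c (j + 2) (k + n₀) *
      (wpNum α (b - (j + 2 : ℕ)) c (k + n₀) - wpLow α (b - (j + 2 : ℕ)) c (k + n₀)) =
      -wpExcess α (b - j) c * ((α + 2 * (k + n₀ : ℕ)) * wpSeq α b c j (k + n₀)) -
        wpCoeffOne α (b - (j + 2 : ℕ)) c *
          ((α + 2 * (k + n₀ : ℕ)) * wpSeq α b c (j + 1) (k + n₀)) -
        wpCoeffTwo α (b - (j + 2 : ℕ)) c *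
          ((α + 2 * (k + n₀ : ℕ)) * wpSeq α b c (j + 2) (k + n₀)) := by
    intro k
    have h1 := wpSeq_eq_wpSeq_succ_mul α b c (j := j) (n := k + n₀) (by omega)
    have h2 := wpSeq_eq_wpSeq_succ_mul α b c (j := j + 1) (n := k + n₀) (by omega)
    rw [wpNum_sub_wpLow, h1, h2, e2]
    generalize wpCoeffOne α (b - (j + 2 : ℕ)) c = k₁
    generalize wpCoeffTwo α (b - (j + 2 : ℕ)) c = k₂
    generalize wpExcess α (b - j) c = σ
    generalize wpSeq α b c (j + 1 + 1) (k + n₀) = h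
    push_cast
    ring
  have htel := (isWellPoised_wpSeq α b c (j + 2)).tsum_telescope hσ2 hn
    (by
      simp_rw [hterm]
      exact ((hs0.mul_left _).sub (hs1.mul_left _)).sub (hs2.mul_left _))
  simp_rw [hterm] at htel
  rw [((hs0.mul_left _).sub (hs1.mul_left _)).tsum_sub (hs2.mul_left _),
    (hs0.mul_left _).tsum_sub (hs1.mul_left _), tsum_mul_left, tsum_mul_left, tsum_mul_left] at htel
  change _ * wpTail α b c n₀ j - _ * wpTail α b c n₀ (j + 1) - _ * wpTail α b c n₀ (j + 2) = _
    at htel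
  linear_combination -htel

/-- On the half-plane of convergence, iterating the recurrence does not change the value. -/
theorem wpContTail_eq {α b : ℂ} {c : Fin 4 → ℂ} {n₀ : ℕ} (K j : ℕ)
    (hσ : 0 < (wpExcess α (b - j) c).re) (hn : j + 2 * K ≤ n₀) :
    wpContTail α b c n₀ K j = (Gamma (wpExcess α (b - j) c))⁻¹ * wpTail α b c n₀ j := by
  induction K generalizing j with
  | zero => rfl
  | succ K ih =>
    have e1 : wpExcess α (b - (j + 1 : ℕ)) c = wpExcess α (b - j) c + 1 := by
      simp only [wpExcess_sub_natCast]; push_cast; ring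
    have e2 : wpExcess α (b - (j + 2 : ℕ)) c = wpExcess α (b - j) c + 1 + 1 := by
      simp only [wpExcess_sub_natCast]; push_cast; ring
    rw [wpContTail, ih (j + 1) (by rw [e1, add_re, one_re]; linarith) (by omega),
      ih (j + 2) (by rw [e2, add_re, add_re, one_re]; linarith) (by omega), e1, e2,
      one_div_Gamma_eq_self_mul_one_div_Gamma_add_one (wpExcess α (b - j) c),
      one_div_Gamma_eq_self_mul_one_div_Gamma_add_one (wpExcess α (b - j) c + 1)]
    have := wpExcess_mul_wpTail hσ (n₀ := n₀) (by omega)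
    linear_combination -((wpExcess α (b - j) c + 1) *
      (Gamma (wpExcess α (b - j) c + 1 + 1))⁻¹) * this

theorem wpContTail_neg_natCast {m n₀ : ℕ} (hm : m < n₀) (b : ℂ) (c : Fin 4 → ℂ) (K j : ℕ) :
    wpContTail (-m) b c n₀ K j = 0 := by
  induction K generalizing j with
  | zero =>
    rw [wpContTail, wpTail]
    simp_rw [wpSeq_neg_natCast m b c j (Nat.lt_add_left _ hm)]
    simp
  | succ K ih =>
    rw [wpContTail, ih, ih, wpSeq_neg_natCast m b c _ hm]
    ring

section Holomorphy

variable {E : Type*} [NormedAddCommGroup E] [NormedSpace ℂ E] {α b : E → ℂ} {c : E → Fin 4 → ℂ}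

theorem differentiable_ascPochhammer_eval {f : E → ℂ} (hf : Differentiable ℂ f) (n : ℕ) :
    Differentiable ℂ fun p => (ascPochhammer ℂ n).eval (f p) :=
  (ascPochhammer ℂ n).differentiable.comp hf

theorem differentiable_inv_Gamma {f : E → ℂ} (hf : Differentiable ℂ f) :
    Differentiable ℂ fun p => (Gamma (f p))⁻¹ :=
  differentiable_one_div_Gamma.comp hf

theorem differentiable_wpSeq (hα : Differentiable ℂ α) (hb : Differentiable ℂ b)
    (hc : ∀ i, Differentiable ℂ fun p => c p i) (j n : ℕ) :
    Differentiable ℂ fun p => wpSeq (α p) (b p) (c p) j n := by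
  have h1 := differentiable_ascPochhammer_eval hα n
  have h2 := differentiable_ascPochhammer_eval hb (n - j)
  have h3 := fun i => differentiable_ascPochhammer_eval (hc i) n
  have h4 : Differentiable ℂ fun p => (Gamma (1 + α p - b p + j + n))⁻¹ :=
    differentiable_inv_Gamma (by fun_prop)
  have h5 : ∀ i, Differentiable ℂ fun p => (Gamma (1 + α p - c p i + n))⁻¹ := fun i =>
    differentiable_inv_Gamma (by have := hc i; fun_prop)
  simp only [wpSeq, div_eq_mul_inv, Fin.prod_univ_four]
  exact (((h1.mul h2).mul ((((h3 0).mul (h3 1)).mul (h3 2)).mul (h3 3))).mul_const _).mul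
    (h4.mul ((((h5 0).mul (h5 1)).mul (h5 2)).mul (h5 3)))

theorem differentiable_wpExcess (hα : Differentiable ℂ α) (hb : Differentiable ℂ b)
    (hc : ∀ i, Differentiable ℂ fun p => c p i) :
    Differentiable ℂ fun p => wpExcess (α p) (b p) (c p) := by
  simp only [wpExcess, Fin.sum_univ_four]
  have h0 := hc 0
  have h1 := hc 1
  have h2 := hc 2
  have h3 := hc 3
  fun_prop

theorem differentiableAt_wpTail (hα : Differentiable ℂ α) (hb : Differentiable ℂ b)
    (hc : ∀ i, Differentiable ℂ fun p => c p i) (n₀ j : ℕ) {p₀ : E}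
    (hσ : 0 < (wpExcess (α p₀) (b p₀ - j) (c p₀)).re) :
    DifferentiableAt ℂ (fun p => wpTail (α p) (b p) (c p) n₀ j) p₀ := by
  set s := (wpExcess (α p₀) (b p₀ - j) (c p₀)).re with hs
  set R := ‖α p₀‖ + ‖b p₀ - j‖ + ∑ i, ‖c p₀ i‖ + 1 with hR
  have hc0 : ∀ i, ‖c p₀ i‖ ≤ ∑ i, ‖c p₀ i‖ := fun i =>
    Finset.single_le_sum (f := fun i => ‖c p₀ i‖) (fun _ _ => norm_nonneg _) (Finset.mem_univ i)
  have hs0 : 0 ≤ ∑ i, ‖c p₀ i‖ := Finset.sum_nonneg fun _ _ => norm_nonneg _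
  have hα0 := norm_nonneg (α p₀)
  have hb0 := norm_nonneg (b p₀ - j)
  obtain ⟨n₁, -, -, hn₁⟩ := exists_norm_wellPoised_le R (half_pos hσ).le (half_pos hσ) j
  have hbj : Differentiable ℂ fun p => b p - j := hb.sub_const _
  have hT : ∀ n : ℕ, Differentiable ℂ fun p => (α p + 2 * n) * wpSeq (α p) (b p) (c p) j n :=
    fun n => (hα.add_const _).mul (differentiable_wpSeq hα hb hc j n)
  set D := ‖(α p₀ + 2 * n₁) * wpSeq (α p₀) (b p₀) (c p₀) j n₁‖ + 1 with hD
  have hev : ∀ᶠ p in 𝓝 p₀, ‖α p‖ < R ∧ ‖b p - j‖ < R ∧ (∀ i, ‖c p i‖ < R) ∧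
      s / 2 < (wpExcess (α p) (b p - j) (c p)).re ∧
      ‖(α p + 2 * n₁) * wpSeq (α p) (b p) (c p) j n₁‖ < D := by
    refine Eventually.and ?_ (Eventually.and ?_ (Eventually.and (eventually_all.2 fun i => ?_)
      (Eventually.and ?_ ?_)))
    · exact (hα.continuous.norm.tendsto p₀).eventually_lt_const (by linarith)
    · exact (hbj.continuous.norm.tendsto p₀).eventually_lt_const (by linarith)
    · exact ((hc i).continuous.norm.tendsto p₀).eventually_lt_const (by linarith [hc0 i])
    · exact ((continuous_re.comp (differentiable_wpExcess hα hbj hc).continuous).tendsto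
        p₀).eventually_const_lt (half_lt_self hσ)
    · exact ((hT n₁).continuous.norm.tendsto p₀).eventually_lt_const (lt_add_one _)
  refine differentiableAt_tsum_of_norm_le (V := {p | _}) hev (fun k => hT (k + n₀))
    (u := fun k : ℕ => D * (n₁ : ℝ) ^ (1 + s / 2) * (((k + n₀ : ℕ) : ℝ) ^ (1 + s / 2))⁻¹) ?_ n₁ ?_
  · refine Summable.mul_left _ ?_
    exact (summable_nat_add_iff n₀ (f := fun n : ℕ => ((n : ℝ) ^ (1 + s / 2))⁻¹)).2
      (Real.summable_nat_rpow_inv.2 (by linarith))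
  · rintro k hk p ⟨h1, h2, h3, h4, h5⟩
    refine (hn₁ (α p) (b p - j) (c p) h1.le h2.le (fun i => (h3 i).le) (by linarith) _
      (isWellPoised_wpSeq _ _ _ j) (k + n₀) (by omega)).trans ?_
    gcongr

theorem differentiableAt_wpContTail (hα : Differentiable ℂ α) (hb : Differentiable ℂ b)
    (hc : ∀ i, Differentiable ℂ fun p => c p i) (n₀ K j : ℕ) {p₀ : E}
    (hσ : -(K : ℝ) < (wpExcess (α p₀) (b p₀ - j) (c p₀)).re) :
    DifferentiableAt ℂ (fun p => wpContTail (α p) (b p) (c p) n₀ K j) p₀ := by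
  have hE : ∀ j : ℕ, Differentiable ℂ fun p => wpExcess (α p) (b p - j) (c p) := fun j =>
    differentiable_wpExcess hα (hb.sub_const _) hc
  induction K generalizing j with
  | zero =>
    simp only [wpContTail]
    refine (differentiable_inv_Gamma (hE j) p₀).mul (differentiableAt_wpTail hα hb hc n₀ j ?_)
    simpa using hσ
  | succ K ih =>
    push_cast at hσ
    have e1 : wpExcess (α p₀) (b p₀ - (j + 1 : ℕ)) (c p₀) =
        wpExcess (α p₀) (b p₀ - j) (c p₀) + 1 := by
      simp only [wpExcess_sub_natCast]; push_cast; ring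
    have e2 : wpExcess (α p₀) (b p₀ - (j + 2 : ℕ)) (c p₀) =
        wpExcess (α p₀) (b p₀ - j) (c p₀) + 2 := by
      simp only [wpExcess_sub_natCast]; push_cast; ring
    have h1 := ih (j + 1) (by rw [e1, add_re, one_re]; linarith)
    have h2 := ih (j + 2) (by rw [e2, add_re, re_ofNat]; linarith)
    have hlow : Differentiable ℂ fun p => wpLow (α p) (b p - (j + 2 : ℕ)) (c p) n₀ := by
      simp only [wpLow, Fin.prod_univ_four]
      have h0 := hc 0
      have h1 := hc 1
      have h2 := hc 2
      have h3 := hc 3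
      fun_prop
    have hone : Differentiable ℂ fun p => wpCoeffOne (α p) (b p - (j + 2 : ℕ)) (c p) := by
      have := hE (j + 2)
      simp only [wpCoeffOne, Fin.sum_univ_four]
      have h0 := hc 0
      have h1 := hc 1
      have h2 := hc 2
      have h3 := hc 3
      fun_prop
    have htwo : Differentiable ℂ fun p => wpCoeffTwo (α p) (b p - (j + 2 : ℕ)) (c p) := by
      simp only [wpCoeffTwo, Fin.prod_univ_four]
      have h0 := hc 0
      have h1 := hc 1
      have h2 := hc 2
      have h3 := hc 3
      fun_prop
    simp only [wpContTail]
    exact (((differentiable_inv_Gamma ((hE j).add_const 1) p₀).mul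
      ((differentiable_wpSeq hα hb hc (j + 2) n₀ p₀).mul (hlow p₀))).sub ((hone p₀).mul h1)).sub
      (((htwo p₀).mul ((hE j p₀).add_const 1)).mul h2)

end Holomorphy

/-- The very-well-poised series divided by `Γ` of its excess, continued to the half-plane where
the real part of the excess is larger than `-K`. -/
noncomputable def wpCont (α b : ℂ) (c : Fin 4 → ℂ) (K : ℕ) : ℂ :=
  (Gamma (wpExcess α b c))⁻¹ * ∑ n ∈ Finset.range (2 * K), (α + 2 * n) * wpSeq α b c 0 n +
    wpContTail α b c (2 * K) K 0

theorem wpCont_eq {α b : ℂ} {c : Fin 4 → ℂ} (K : ℕ) (hσ : 0 < (wpExcess α b c).re) :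
    wpCont α b c K =
      (Gamma (wpExcess α b c))⁻¹ * ∑' n : ℕ, (α + 2 * n) * wpSeq α b c 0 n := by
  have e : b - (0 : ℕ) = b := by simp
  have hs := summable_wpSeq (j := 0) (by rwa [e] : 0 < (wpExcess α (b - (0 : ℕ)) c).re) 0
  have h := hs.sum_add_tsum_nat_add (2 * K)
  simp only [Nat.add_zero] at h
  rw [wpCont, wpContTail_eq K 0 (by rwa [e]) (by omega), e, ← mul_add, wpTail, h]

theorem wpCont_neg_natCast {m K : ℕ} (hm : m < 2 * K) (b : ℂ) (c : Fin 4 → ℂ) :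
    wpCont (-m) b c K = 0 := by
  rw [wpCont, wpContTail_neg_natCast hm, sum_wpSeq_neg_natCast m b c hm, mul_zero, add_zero]

theorem differentiableAt_wpCont {E : Type*} [NormedAddCommGroup E] [NormedSpace ℂ E]
    {α b : E → ℂ} {c : E → Fin 4 → ℂ} (hα : Differentiable ℂ α) (hb : Differentiable ℂ b)
    (hc : ∀ i, Differentiable ℂ fun p => c p i) (K : ℕ) {p₀ : E}
    (hσ : -(K : ℝ) < (wpExcess (α p₀) (b p₀) (c p₀)).re) :
    DifferentiableAt ℂ (fun p => wpCont (α p) (b p) (c p) K) p₀ := by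
  simp only [wpCont]
  refine ((differentiable_inv_Gamma (differentiable_wpExcess hα hb hc) p₀).mul ?_).add
    (differentiableAt_wpContTail hα hb hc (2 * K) K 0 (by simpa using hσ))
  exact DifferentiableAt.fun_sum fun n _ =>
    ((hα.add_const _).mul (differentiable_wpSeq hα hb hc 0 n)) p₀

/-! ### The Wilson function -/

theorem notNonposInt_iff_Gamma_ne_zero {z : ℂ} : NotNonposInt z ↔ Gamma z ≠ 0 := by
  rw [Ne, Gamma_eq_zero_iff, not_exists]
  rfl

theorem isOpen_setOf_notNonposInt : IsOpen {z : ℂ | NotNonposInt z} := by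
  have : {z : ℂ | NotNonposInt z} = {z : ℂ | (Gamma z)⁻¹ ≠ 0} := by
    ext z
    simp only [mem_ofPred_eq, notNonposInt_iff_Gamma_ne_zero, ne_eq, inv_eq_zero]
  rw [this]
  exact isOpen_ne_fun differentiable_one_div_Gamma.continuous continuous_const

theorem notNonposInt_of_im_ne_zero {z : ℂ} (hz : z.im ≠ 0) : NotNonposInt z := by
  intro n h
  rw [h] at hz
  simp at hz

theorem NotNonposInt.differentiableAt_Gamma {z : ℂ} (hz : NotNonposInt z) :
    DifferentiableAt ℂ Gamma z :=
  Complex.differentiableAt_Gamma z hz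

theorem NotNonposInt.ascPochhammer_eval_ne_zero {z : ℂ} (hz : NotNonposInt z) (n : ℕ) :
    (ascPochhammer ℂ n).eval z ≠ 0 := by
  rw [Ne, ascPochhammer_eval_eq_zero_iff]
  rintro ⟨k, -, hk⟩
  exact hz k (by rw [hk, neg_neg])

theorem inv_Gamma_add_natCast_mul (z : ℂ) (n : ℕ) :
    (Gamma (z + n))⁻¹ * (ascPochhammer ℂ n).eval z = (Gamma z)⁻¹ := by
  induction n with
  | zero => simp
  | succ n ih =>
    rw [← ih, one_div_Gamma_eq_self_mul_one_div_Gamma_add_one (z + n), ascPochhammer_succ_eval]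
    push_cast
    ring_nf

theorem mul_ascPochhammer_eval_add_one (z : ℂ) (n : ℕ) :
    z * (ascPochhammer ℂ n).eval (z + 1) = (z + n) * (ascPochhammer ℂ n).eval z := by
  induction n with
  | zero => simp
  | succ n ih =>
    rw [ascPochhammer_succ_eval, ascPochhammer_succ_eval, ← mul_assoc, ih]
    push_cast
    ring

/-- The terms of Bailey's series `W(α; b, c 0, …, c 3)` and the regularised terms agree up to a
factor that does not depend on the index. -/
theorem mul_wpSeq_eq_baileyWTerm {α b : ℂ} {c : Fin 4 → ℂ} (hα : NotNonposInt α)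
    (hb : NotNonposInt (1 + α - b)) (hc : ∀ i, NotNonposInt (1 + α - c i)) (n : ℕ) :
    (α + 2 * n) * wpSeq α b c 0 n =
      α * ((Gamma (1 + α - b))⁻¹ * ∏ i, (Gamma (1 + α - c i))⁻¹) *
        baileyWTerm α b (c 0) (c 1) (c 2) (c 3) n := by
  have hα2 : NotNonposInt (α / 2) := by
    intro k hk
    refine hα (2 * k) ?_
    push_cast
    linear_combination 2 * hk
  have h1 := mul_ascPochhammer_eval_add_one (α / 2) n
  rw [add_comm (α / 2) 1] at h1
  have hg : ∀ z : ℂ, NotNonposInt z →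
      (Gamma (z + n))⁻¹ = (Gamma z)⁻¹ * ((ascPochhammer ℂ n).eval z)⁻¹ := by
    intro z hz
    rw [← inv_Gamma_add_natCast_mul z n, mul_assoc, mul_inv_cancel₀
      (hz.ascPochhammer_eval_ne_zero n), mul_one]
  have h2 : (ascPochhammer ℂ n).eval (1 + α / 2) * α * ((ascPochhammer ℂ n).eval (α / 2))⁻¹ =
      α + 2 * n := by
    rw [← div_eq_mul_inv, div_eq_iff (hα2.ascPochhammer_eval_ne_zero n)]
    linear_combination 2 * h1
  rw [← h2]
  simp only [wpSeq, baileyWTerm, hypergeometricTerm, List.map_cons, List.map_nil, List.prod_cons,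
    List.prod_nil, Fin.prod_univ_four, Nat.sub_zero, Nat.cast_zero, add_zero, hg _ hb, hg _ (hc _),
    one_pow, div_eq_mul_inv, mul_inv, mul_one, one_mul]
  generalize (Gamma (1 + α - b))⁻¹ = g
  generalize (Gamma (1 + α - c 0))⁻¹ = g₀
  generalize (Gamma (1 + α - c 1))⁻¹ = g₁
  generalize (Gamma (1 + α - c 2))⁻¹ = g₂
  generalize (Gamma (1 + α - c 3))⁻¹ = g₃
  generalize ((ascPochhammer ℂ n).eval (α * 2⁻¹))⁻¹ = q
  generalize (ascPochhammer ℂ n).eval (1 + α * 2⁻¹) = q'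
  generalize ((ascPochhammer ℂ n).eval (1 + α - b))⁻¹ = r
  generalize ((ascPochhammer ℂ n).eval (1 + α - c 0))⁻¹ = r₀
  generalize ((ascPochhammer ℂ n).eval (1 + α - c 1))⁻¹ = r₁
  generalize ((ascPochhammer ℂ n).eval (1 + α - c 2))⁻¹ = r₂
  generalize ((ascPochhammer ℂ n).eval (1 + α - c 3))⁻¹ = r₃
  ring

section Wilson

variable (a b c d : ℂ)

/-- The upper parameters of the very-well-poised series of the Wilson function other than
`wilsonBase` and `a + ix`; the argument `γ` stands for `a - ix`. -/
noncomputable def wilsonUpper (l γ : ℂ) : Fin 4 → ℂ :=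
  ![γ, dualA a b c d + I * l, dualB a b c d + I * l, dualC a b c d + I * l]

theorem wpExcess_wilson (l x : ℂ) :
    wpExcess (wilsonBase a b c d l) (a + I * x) (wilsonUpper a b c d l (a - I * x)) =
      1 - dualD a b c d - I * l := by
  simp only [wpExcess, wilsonBase, wilsonUpper, Fin.sum_univ_four, Matrix.cons_val, dualA, dualB,
    dualC, dualD]
  ring

/-- The very-well-poised series of the Wilson function, with regularised terms. -/
noncomputable def wilsonSeries (l x : ℂ) : ℂ :=
  ∑' n : ℕ, (wilsonBase a b c d l + 2 * n) *
    wpSeq (wilsonBase a b c d l) (a + I * x) (wilsonUpper a b c d l (a - I * x)) 0 n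

theorem summable_wilsonSeries {l : ℂ} (x : ℂ) (hl : 0 < (1 - dualD a b c d - I * l).re) :
    Summable fun n : ℕ => (wilsonBase a b c d l + 2 * n) *
      wpSeq (wilsonBase a b c d l) (a + I * x) (wilsonUpper a b c d l (a - I * x)) 0 n := by
  have h := isWellPoised_wpSeq (wilsonBase a b c d l) (a + I * x)
    (wilsonUpper a b c d l (a - I * x)) 0
  rw [Nat.cast_zero, sub_zero] at h
  exact summable_wellPoised h (by rwa [wpExcess_wilson])

variable {a b c d}

theorem mul_wpSeq_eq_wilsonTerm (hab : NotNonposInt (a + b)) (hac : NotNonposInt (a + c))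
    (had : NotNonposInt (1 + a - d)) {l x : ℂ} (h : (l, x) ∈ wilsonDomain a b c d) (n : ℕ) :
    (wilsonBase a b c d l + 2 * n) *
        wpSeq (wilsonBase a b c d l) (a + I * x) (wilsonUpper a b c d l (a - I * x)) 0 n =
      wilsonBase a b c d l *
        ((Gamma (dualB a b c d + c + I * l - I * x))⁻¹ *
          ((Gamma (dualB a b c d + c + I * l + I * x))⁻¹ * (Gamma (1 + a - d))⁻¹ *
            (Gamma (a + c))⁻¹ * (Gamma (a + b))⁻¹)) * wilsonTerm a b c d l x n := by
  obtain ⟨-, hα, hp, hm⟩ := h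
  simp only at hα hp hm
  have e0 : 1 + wilsonBase a b c d l - (a + I * x) = dualB a b c d + c + I * l - I * x := by
    simp only [wilsonBase, dualA, dualB, dualC]; ring
  have e1 : 1 + wilsonBase a b c d l - (a - I * x) = dualB a b c d + c + I * l + I * x := by
    simp only [wilsonBase, dualA, dualB, dualC]; ring
  have e2 : 1 + wilsonBase a b c d l - (dualA a b c d + I * l) = 1 + a - d := by
    simp only [wilsonBase, dualA, dualB, dualC]; ring
  have e3 : 1 + wilsonBase a b c d l - (dualB a b c d + I * l) = a + c := by
    simp only [wilsonBase, dualA, dualB, dualC]; ring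
  have e4 : 1 + wilsonBase a b c d l - (dualC a b c d + I * l) = a + b := by
    simp only [wilsonBase, dualA, dualB, dualC]; ring
  have hc : ∀ i, NotNonposInt (1 + wilsonBase a b c d l - wilsonUpper a b c d l (a - I * x) i) := by
    intro i
    fin_cases i
    · exact e1 ▸ hp
    · exact e2 ▸ had
    · exact e3 ▸ hac
    · exact e4 ▸ hab
  have := mul_wpSeq_eq_baileyWTerm hα (e0 ▸ hm) hc n
  simp only [wilsonUpper, Fin.prod_univ_four, Matrix.cons_val, e0, e1, e2, e3, e4] at this
  exact this

theorem wilsonFormula_eq (hab : NotNonposInt (a + b)) (hac : NotNonposInt (a + c))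
    (had : NotNonposInt (1 + a - d)) {l x : ℂ} (h : (l, x) ∈ wilsonDomain a b c d) :
    wilsonFormula a b c d l x = Gamma (wilsonBase a b c d l) *
      ((Gamma (1 - dualD a b c d - I * l))⁻¹ * wilsonSeries a b c d l x) := by
  have hα : wilsonBase a b c d l ≠ 0 := by simpa using h.2.1 0
  have e : dualA a b c d + dualB a b c d + dualC a b c d + I * l = wilsonBase a b c d l + 1 := by
    simp only [wilsonBase]; ring
  rw [wilsonSeries]
  simp_rw [mul_wpSeq_eq_wilsonTerm hab hac had h]
  rw [tsum_mul_left, wilsonFormula, e, Complex.Gamma_add_one _ hα, baileyW]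
  change _ * ∑' n, wilsonTerm a b c d l x n = _
  simp only [div_eq_mul_inv, mul_inv]
  ring

theorem summable_wilsonTerm (hab : NotNonposInt (a + b)) (hac : NotNonposInt (a + c))
    (had : NotNonposInt (1 + a - d)) {l x : ℂ} (h : (l, x) ∈ wilsonDomain a b c d) :
    Summable (wilsonTerm a b c d l x) := by
  have hs := summable_wilsonSeries a b c d x h.1
  simp_rw [mul_wpSeq_eq_wilsonTerm hab hac had h] at hs
  refine (summable_mul_left_iff ?_).1 hs
  have hg : ∀ z : ℂ, NotNonposInt z → (Gamma z)⁻¹ ≠ 0 := fun z hz =>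
    inv_ne_zero (notNonposInt_iff_Gamma_ne_zero.1 hz)
  have hα : wilsonBase a b c d l ≠ 0 := by simpa using h.2.1 0
  exact mul_ne_zero hα (mul_ne_zero (hg _ h.2.2.2) (mul_ne_zero (mul_ne_zero (mul_ne_zero
    (hg _ h.2.2.1) (hg _ had)) (hg _ hac)) (hg _ hab)))

variable (a b c d)

/-- The series of the Wilson function divided by `Γ` of its excess, continued to the half-plane
where the real part of the excess is larger than `-K`. -/
noncomputable def wilsonCont (K : ℕ) (l x : ℂ) : ℂ :=
  wpCont (wilsonBase a b c d l) (a + I * x) (wilsonUpper a b c d l (a - I * x)) K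

theorem wilsonCont_eq (K : ℕ) {l : ℂ} (x : ℂ) (hl : 0 < (1 - dualD a b c d - I * l).re) :
    wilsonCont a b c d K l x =
      (Gamma (1 - dualD a b c d - I * l))⁻¹ * wilsonSeries a b c d l x := by
  rw [wilsonCont, wpCont_eq K (by rwa [wpExcess_wilson]), wpExcess_wilson, wilsonSeries]

theorem differentiableAt_wilsonCont (K : ℕ) {p : ℂ × ℂ}
    (hp : -(K : ℝ) < (1 - dualD a b c d - I * p.1).re) :
    DifferentiableAt ℂ (fun p : ℂ × ℂ => wilsonCont a b c d K p.1 p.2) p := by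
  refine differentiableAt_wpCont (α := fun p : ℂ × ℂ => wilsonBase a b c d p.1)
    (b := fun p => a + I * p.2) (c := fun p => wilsonUpper a b c d p.1 (a - I * p.2))
    ?_ ?_ ?_ K (by rwa [wpExcess_wilson])
  · simp only [wilsonBase]; fun_prop
  · fun_prop
  · intro i
    fin_cases i <;> simp only [wilsonUpper] <;> simp

theorem differentiableAt_slice {f : ℂ → ℂ → ℂ} {l x : ℂ}
    (h : DifferentiableAt ℂ (fun p : ℂ × ℂ => f p.1 p.2) (l, x)) :
    DifferentiableAt ℂ (fun t => f t x) l :=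
  DifferentiableAt.comp l (g := fun p : ℂ × ℂ => f p.1 p.2) (f := fun t => (t, x)) h
    (differentiableAt_id.prodMk (differentiableAt_const x))

theorem re_excess_eq (l : ℂ) :
    (1 - dualD a b c d - I * l).re = (1 - dualD a b c d).re + l.im := by
  simp

/-- Two continuations agree where both are holomorphic. -/
theorem wilsonCont_eq_wilsonCont {K K' : ℕ} (hK : K ≤ K') {l : ℂ} (x : ℂ)
    (hl : -(K : ℝ) < (1 - dualD a b c d - I * l).re) :
    wilsonCont a b c d K l x = wilsonCont a b c d K' l x := by
  set r := (1 - dualD a b c d).re with hr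
  set U : Set ℂ := {l | -(K : ℝ) - r < l.im} with hU
  have hUo : IsOpen U := isOpen_lt continuous_const continuous_im
  have hUc : IsPreconnected U := (convex_halfSpace_im_gt _).isPreconnected
  have hmem : ∀ t ∈ U, -(K : ℝ) < (1 - dualD a b c d - I * t).re := by
    intro t ht
    rw [re_excess_eq]
    have : -(K : ℝ) - r < t.im := ht
    linarith
  have hKK : (K : ℝ) ≤ K' := by exact_mod_cast hK
  have hf : AnalyticOnNhd ℂ (fun t => wilsonCont a b c d K t x) U :=
    DifferentiableOn.analyticOnNhd (fun t ht => (differentiableAt_slice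
      (differentiableAt_wilsonCont a b c d K (p := (t, x)) (hmem t ht))).differentiableWithinAt) hUo
  have hg : AnalyticOnNhd ℂ (fun t => wilsonCont a b c d K' t x) U :=
    DifferentiableOn.analyticOnNhd (fun t ht => (differentiableAt_slice
      (differentiableAt_wilsonCont a b c d K' (p := (t, x))
        (by linarith [hmem t ht] : -(K' : ℝ) < _))).differentiableWithinAt) hUo
  have hz : I * (1 - r : ℝ) ∈ {t : ℂ | -r < t.im} := by simp
  have hK0 : (0 : ℝ) ≤ K := Nat.cast_nonneg K
  refine hf.eqOn_of_preconnected_of_eventuallyEq hg hUc (z₀ := I * (1 - r : ℝ)) ?_ ?_ ?_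
  · change -(K : ℝ) - r < _
    have : -r < (I * (1 - r : ℝ)).im := hz
    linarith
  · filter_upwards [(isOpen_lt continuous_const continuous_im).mem_nhds hz] with t ht
    have ht : -r < t.im := ht
    have ht0 : 0 < (1 - dualD a b c d - I * t).re := by rw [re_excess_eq]; linarith
    rw [wilsonCont_eq a b c d K x ht0, wilsonCont_eq a b c d K' x ht0]
  · change -(K : ℝ) - r < l.im
    rw [re_excess_eq] at hl
    linarith

/-- The Wilson function divided by `Γ(wilsonBase)`, as an entire function of two variables. The number
of iterations is large enough for the continuation to be holomorphic at `l`; its value does not depend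
on this choice. -/
noncomputable def wilsonReg (l x : ℂ) : ℂ :=
  wilsonCont a b c d (⌈-(1 - dualD a b c d - I * l).re⌉₊ + 1) l x

theorem wilsonReg_eq {K : ℕ} {l : ℂ} (x : ℂ) (hl : -(K : ℝ) < (1 - dualD a b c d - I * l).re) :
    wilsonReg a b c d l x = wilsonCont a b c d K l x := by
  set K₀ := ⌈-(1 - dualD a b c d - I * l).re⌉₊ + 1 with hK₀
  have h0 : -(K₀ : ℝ) < (1 - dualD a b c d - I * l).re := by
    have := Nat.le_ceil (-(1 - dualD a b c d - I * l).re)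
    rw [hK₀]
    push_cast
    linarith
  change wilsonCont a b c d K₀ l x = _
  rcases le_total K₀ K with h | h
  · exact wilsonCont_eq_wilsonCont a b c d h x h0
  · exact (wilsonCont_eq_wilsonCont a b c d h x hl).symm

theorem differentiable_wilsonReg :
    Differentiable ℂ fun p : ℂ × ℂ => wilsonReg a b c d p.1 p.2 := by
  intro p
  obtain ⟨K, hK⟩ := exists_nat_gt (-(1 - dualD a b c d - I * p.1).re)
  have hK : -(K : ℝ) < (1 - dualD a b c d - I * p.1).re := by linarith
  refine (differentiableAt_wilsonCont a b c d K hK).congr_of_eventuallyEq ?_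
  have hc : Continuous fun p : ℂ × ℂ => (1 - dualD a b c d - I * p.1).re := by fun_prop
  filter_upwards [(hc.tendsto p).eventually_const_lt hK] with q hq
  exact wilsonReg_eq a b c d q.2 hq

theorem wilsonReg_eq_series {l : ℂ} (x : ℂ) (hl : 0 < (1 - dualD a b c d - I * l).re) :
    wilsonReg a b c d l x =
      (Gamma (1 - dualD a b c d - I * l))⁻¹ * wilsonSeries a b c d l x := by
  rw [wilsonReg_eq a b c d (K := 0) x (by simpa using hl), wilsonCont_eq a b c d 0 x hl]

theorem wilsonReg_eq_zero {l : ℂ} (x : ℂ) (m : ℕ) (hl : wilsonBase a b c d l = -m) :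
    wilsonReg a b c d l x = 0 := by
  obtain ⟨K, hK⟩ := exists_nat_gt (max (-(1 - dualD a b c d - I * l).re) m)
  have h1 : -(K : ℝ) < (1 - dualD a b c d - I * l).re := by
    linarith [(le_max_left _ _).trans_lt hK]
  have h2 : m < K := by exact_mod_cast (le_max_right _ _).trans_lt hK
  rw [wilsonReg_eq a b c d x h1, wilsonCont, hl, wpCont_neg_natCast (by omega)]

/-- The Wilson function `φ_λ(x)`; the limit removes the singularities of `Γ(wilsonBase)`. -/
noncomputable def wilsonFun (l x : ℂ) : ℂ :=
  limUnder (𝓝[≠] l) fun t => Gamma (wilsonBase a b c d t) * wilsonReg a b c d t x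

theorem continuous_wilsonBase : Continuous (wilsonBase a b c d) := by
  unfold wilsonBase; fun_prop

theorem differentiable_wilsonBase : Differentiable ℂ (wilsonBase a b c d) := by
  unfold wilsonBase; fun_prop

theorem wilsonBase_eq_add (l t : ℂ) :
    wilsonBase a b c d t = wilsonBase a b c d l + I * (t - l) := by
  unfold wilsonBase; ring

theorem differentiable_wilsonReg_left (x : ℂ) : Differentiable ℂ fun t => wilsonReg a b c d t x :=
  fun t => differentiableAt_slice (differentiable_wilsonReg a b c d (t, x))

theorem wilsonFun_eq {l : ℂ} (x : ℂ) (hl : NotNonposInt (wilsonBase a b c d l)) :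
    wilsonFun a b c d l x = Gamma (wilsonBase a b c d l) * wilsonReg a b c d l x := by
  refine Tendsto.limUnder_eq ?_
  have h : DifferentiableAt ℂ
      (fun t => Gamma (wilsonBase a b c d t) * wilsonReg a b c d t x) l :=
    (hl.differentiableAt_Gamma.comp l (differentiable_wilsonBase a b c d l)).mul
      (differentiable_wilsonReg_left a b c d x l)
  exact h.continuousAt.tendsto.mono_left nhdsWithin_le_nhds

theorem differentiableAt_wilsonFun_of_notNonposInt {l : ℂ} (x : ℂ)
    (hl : NotNonposInt (wilsonBase a b c d l)) :
    DifferentiableAt ℂ (fun p : ℂ × ℂ => wilsonFun a b c d p.1 p.2) (l, x) := by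
  have h : DifferentiableAt ℂ (fun p : ℂ × ℂ =>
      Gamma (wilsonBase a b c d p.1) * wilsonReg a b c d p.1 p.2) (l, x) :=
    (DifferentiableAt.comp (l, x) (f := fun p : ℂ × ℂ => wilsonBase a b c d p.1)
      hl.differentiableAt_Gamma
      ((differentiable_wilsonBase a b c d).comp differentiable_fst (l, x))).mul
      (differentiable_wilsonReg a b c d (l, x))
  refine h.congr_of_eventuallyEq ?_
  have hc : Continuous fun p : ℂ × ℂ => wilsonBase a b c d p.1 :=
    (continuous_wilsonBase a b c d).comp continuous_fst
  filter_upwards [hc.continuousAt.preimage_mem_nhds (isOpen_setOf_notNonposInt.mem_nhds hl)]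
    with q hq
  exact wilsonFun_eq a b c d q.2 hq

theorem notNonposInt_wilsonBase_of_mem_ball {l t : ℂ} {m : ℕ} (hl : wilsonBase a b c d l = -m)
    (ht : t ∈ ball l 1) (htl : t ≠ l) : NotNonposInt (wilsonBase a b c d t) := by
  intro n hn
  rw [wilsonBase_eq_add a b c d l t, hl] at hn
  have h1 : I * (t - l) = ((m - n : ℤ) : ℂ) := by push_cast; linear_combination hn
  have h2 : ‖I * (t - l)‖ < 1 := by
    rw [norm_mul, norm_I, one_mul, ← dist_eq_norm]; exact ht
  rw [h1, norm_intCast] at h2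
  have h3 : ((m : ℤ) - n) = 0 := by
    rw [← Int.abs_lt_one_iff]
    exact_mod_cast h2
  rw [h3, Int.cast_zero, mul_eq_zero, sub_eq_zero] at h1
  exact h1.elim I_ne_zero htl

/-- Holomorphy in `λ` at a zero of `wilsonReg` that compensates a pole of `Γ(wilsonBase)`. -/
theorem differentiableAt_wilsonFun_left {l : ℂ} (x : ℂ) {m : ℕ}
    (hl : wilsonBase a b c d l = -m) :
    DifferentiableAt ℂ (fun t => wilsonFun a b c d t x) l := by
  set k : ℂ → ℂ := fun t => dslope (fun t => wilsonReg a b c d t x) l t *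
    (Gamma (wilsonBase a b c d t + (m + 1 : ℕ)) *
      (I * (ascPochhammer ℂ m).eval (wilsonBase a b c d t))⁻¹) with hk_def
  have hk : DifferentiableAt ℂ k l := by
    have hd : DifferentiableAt ℂ (dslope (fun t => wilsonReg a b c d t x) l) l :=
      ((differentiableOn_dslope univ_mem).2
        (differentiable_wilsonReg_left a b c d x).differentiableOn).differentiableAt univ_mem
    have hG : DifferentiableAt ℂ (fun t => Gamma (wilsonBase a b c d t + (m + 1 : ℕ))) l := by
      refine DifferentiableAt.comp l (g := Gamma) ?_
        ((differentiable_wilsonBase a b c d l).add_const _)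
      have : wilsonBase a b c d l + (m + 1 : ℕ) = 1 := by rw [hl]; push_cast; ring
      rw [this]
      exact Complex.differentiableAt_Gamma_one
    have hP : DifferentiableAt ℂ
        (fun t => I * (ascPochhammer ℂ m).eval (wilsonBase a b c d t)) l :=
      (differentiable_ascPochhammer_eval (differentiable_wilsonBase a b c d) m l).const_mul I
    refine hd.mul (hG.mul (hP.inv (mul_ne_zero I_ne_zero ?_)))
    rw [hl, Ne, ascPochhammer_eval_eq_zero_iff]
    rintro ⟨j, hj, hj'⟩
    rw [neg_neg, Nat.cast_inj] at hj'
    omega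
  have heq : ∀ t ∈ ball l 1, t ≠ l →
      Gamma (wilsonBase a b c d t) * wilsonReg a b c d t x = k t := by
    intro t ht htl
    have hN := notNonposInt_wilsonBase_of_mem_ball a b c d hl ht htl
    have htl' : t - l ≠ 0 := sub_ne_zero.2 htl
    have h1 : wilsonBase a b c d t + m = I * (t - l) := by
      rw [wilsonBase_eq_add a b c d l t, hl]; ring
    have hG := inv_Gamma_add_natCast_mul (wilsonBase a b c d t) (m + 1)
    have hG0 : Gamma (wilsonBase a b c d t) ≠ 0 := notNonposInt_iff_Gamma_ne_zero.1 hN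
    have hP := hN.ascPochhammer_eval_ne_zero m
    have hG1 : Gamma (wilsonBase a b c d t + (m + 1 : ℕ)) ≠ 0 := by
      intro h0
      rw [h0, inv_zero, zero_mul] at hG
      exact inv_ne_zero hG0 hG.symm
    have hG2 : Gamma (wilsonBase a b c d t + (m + 1 : ℕ)) = Gamma (wilsonBase a b c d t) *
        ((ascPochhammer ℂ m).eval (wilsonBase a b c d t) * (I * (t - l))) := by
      rw [ascPochhammer_succ_eval, h1] at hG
      field_simp at hG
      linear_combination -hG
    simp only [hk_def]
    rw [dslope_of_ne _ htl, slope_def_field, wilsonReg_eq_zero a b c d x m hl, hG2, mul_inv]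
    field_simp [I_ne_zero]
    ring
  have hball : ball l 1 ∈ 𝓝 l := ball_mem_nhds l one_pos
  have hval : wilsonFun a b c d l x = k l := by
    refine Tendsto.limUnder_eq ((hk.continuousAt.tendsto.mono_left nhdsWithin_le_nhds).congr' ?_)
    filter_upwards [nhdsWithin_le_nhds hball, self_mem_nhdsWithin] with t ht htl
    exact (heq t ht htl).symm
  refine hk.congr_of_eventuallyEq ?_
  filter_upwards [hball] with t ht
  by_cases htl : t = l
  · rw [htl, hval]
  · rw [← heq t ht htl,
      wilsonFun_eq a b c d x (notNonposInt_wilsonBase_of_mem_ball a b c d hl ht htl)]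

theorem differentiable_wilsonFun :
    Differentiable ℂ fun p : ℂ × ℂ => wilsonFun a b c d p.1 p.2 := by
  rintro ⟨l, x⟩
  by_cases hl : NotNonposInt (wilsonBase a b c d l)
  · exact differentiableAt_wilsonFun_of_notNonposInt a b c d x hl
  · obtain ⟨m, hm⟩ : ∃ m : ℕ, wilsonBase a b c d l = -m := by
      simpa [NotNonposInt] using hl
    refine differentiableAt_of_differentiableAt_off_line one_pos (fun y _ t ht => ?_)
      fun t ht htl y _ => differentiableAt_wilsonFun_of_notNonposInt a b c d y
        (notNonposInt_wilsonBase_of_mem_ball a b c d hm ht htl)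
    by_cases htl : t = l
    · rw [htl]
      exact (differentiableAt_wilsonFun_left a b c d y hm).differentiableWithinAt
    · exact (differentiableAt_slice (differentiableAt_wilsonFun_of_notNonposInt a b c d y
        (notNonposInt_wilsonBase_of_mem_ball a b c d hm ht htl))).differentiableWithinAt

variable {a b c d}

theorem isWilsonFunction_wilsonFun (hab : NotNonposInt (a + b)) (hac : NotNonposInt (a + c))
    (had : NotNonposInt (1 + a - d)) : IsWilsonFunction a b c d (wilsonFun a b c d) where
  entire := differentiable_wilsonFun a b c d
  eq_formula l x h := by
    rw [wilsonFun_eq a b c d x h.2.1, wilsonReg_eq_series a b c d x h.1,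
      wilsonFormula_eq hab hac had h]

end Wilson

/-! ### Uniqueness and the difference equation -/

theorem isOpen_setOf_mem_wilsonDomain (a b c d x : ℂ) :
    IsOpen {l : ℂ | (l, x) ∈ wilsonDomain a b c d} := by
  have h : ∀ f : ℂ → ℂ, Continuous f → IsOpen {l : ℂ | NotNonposInt (f l)} := fun f hf =>
    isOpen_setOf_notNonposInt.preimage hf
  refine IsOpen.and (isOpen_lt continuous_const (by fun_prop)) (IsOpen.and (h _ ?_)
    (IsOpen.and (h _ (by fun_prop)) (h _ (by fun_prop))))
  exact continuous_wilsonBase a b c d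

/-- For `λ` high up in a suitable direction, the formula applies to `x` and to its shifts by `±i`. -/
theorem exists_mem_wilsonDomain (a b c d x : ℂ) :
    ∃ l : ℂ, (l, x) ∈ wilsonDomain a b c d ∧ (l, x + I) ∈ wilsonDomain a b c d ∧
      (l, x + -I) ∈ wilsonDomain a b c d := by
  set u := (dualA a b c d + dualB a b c d + dualC a b c d).im with hu
  set v := (dualB a b c d + c).im with hv
  set r : ℝ := 1 + |u| + |v| + |x.re| with hr
  set s : ℝ := 1 - (1 - dualD a b c d).re with hs
  have hu' := neg_abs_le u
  have hv' := neg_abs_le v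
  have hx1 := neg_abs_le x.re
  have hx2 := le_abs_self x.re
  have h1 := abs_nonneg u
  have h2 := abs_nonneg v
  have h3 := abs_nonneg x.re
  have key : ∀ y : ℂ, y.re = x.re → ((⟨r, s⟩ : ℂ), y) ∈ wilsonDomain a b c d := by
    intro y hy
    refine ⟨?_, notNonposInt_of_im_ne_zero (ne_of_gt ?_), notNonposInt_of_im_ne_zero (ne_of_gt ?_),
      notNonposInt_of_im_ne_zero (ne_of_gt ?_)⟩
    · rw [re_excess_eq]
      change 0 < _ + s
      linarith
    · have : (wilsonBase a b c d ⟨r, s⟩).im = u + r := by simp [wilsonBase, hu]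
      change 0 < (wilsonBase a b c d ⟨r, s⟩).im
      rw [this]
      linarith
    · have : (dualB a b c d + c + I * ⟨r, s⟩ + I * y).im = v + r + x.re := by simp [hv, hy]
      change 0 < (dualB a b c d + c + I * ⟨r, s⟩ + I * y).im
      rw [this]
      linarith
    · have : (dualB a b c d + c + I * ⟨r, s⟩ - I * y).im = v + r - x.re := by simp [hv, hy]
      change 0 < (dualB a b c d + c + I * ⟨r, s⟩ - I * y).im
      rw [this]
      linarith
  exact ⟨⟨r, s⟩, key x rfl, key (x + I) (by simp), key (x + -I) (by simp)⟩

theorem IsWilsonFunction.eq {a b c d : ℂ} {φ ψ : ℂ → ℂ → ℂ} (hφ : IsWilsonFunction a b c d φ)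
    (hψ : IsWilsonFunction a b c d ψ) : ψ = φ := by
  funext l x
  obtain ⟨l₀, hl₀, -⟩ := exists_mem_wilsonDomain a b c d x
  have hf : Differentiable ℂ fun t => ψ t x := fun t => differentiableAt_slice (hψ.entire (t, x))
  have hg : Differentiable ℂ fun t => φ t x := fun t => differentiableAt_slice (hφ.entire (t, x))
  have := AnalyticOnNhd.eq_of_eventuallyEq (z₀ := l₀)
    (hf.differentiableOn.analyticOnNhd isOpen_univ) (hg.differentiableOn.analyticOnNhd isOpen_univ)
    (by
      filter_upwards [(isOpen_setOf_mem_wilsonDomain a b c d x).mem_nhds hl₀] with t ht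
      rw [hψ.eq_formula t x ht, hφ.eq_formula t x ht])
  exact congrFun this l

/-- Raising the first parameter by one multiplies the terms by a polynomial. -/
theorem wpSeq_raise_left (α b : ℂ) (c : Fin 4 → ℂ) (n : ℕ) :
    b * wpSeq α (b + 1) c 0 n = wpSeq α b c 0 n * ((b + n) * (α - b + n)) := by
  have h1 := mul_ascPochhammer_eval_add_one b n
  have h2 : (Gamma (1 + α - (b + 1) + (0 : ℕ) + n))⁻¹ =
      (α - b + n) * (Gamma (1 + α - b + (0 : ℕ) + n))⁻¹ := by
    rw [one_div_Gamma_eq_self_mul_one_div_Gamma_add_one]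
    push_cast
    ring_nf
  rw [wpSeq, wpSeq, h2, Nat.sub_zero]
  generalize (Gamma (1 + α - b + (0 : ℕ) + n))⁻¹ = g
  simp only [div_eq_mul_inv]
  linear_combination (ascPochhammer ℂ n).eval α * (∏ i, (ascPochhammer ℂ n).eval (c i)) *
    (n.factorial : ℂ)⁻¹ * ((α - b + n) * g * ∏ i, (Gamma (1 + α - c i + n))⁻¹) * h1

theorem wpSeq_swap (α b γ δ ε ζ : ℂ) (n : ℕ) :
    wpSeq α b ![γ, δ, ε, ζ] 0 n = wpSeq α γ ![b, δ, ε, ζ] 0 n := by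
  simp only [wpSeq, Fin.prod_univ_four, Matrix.cons_val, Nat.sub_zero, Nat.cast_zero, add_zero]
  ring

theorem wpSeq_raise_right (α b γ δ ε ζ : ℂ) (n : ℕ) :
    γ * wpSeq α b ![γ + 1, δ, ε, ζ] 0 n =
      wpSeq α b ![γ, δ, ε, ζ] 0 n * ((γ + n) * (α - γ + n)) := by
  rw [wpSeq_swap α b (γ + 1), wpSeq_swap α b γ, wpSeq_raise_left]

/-- The telescoping polynomial in Lagrange form with respect to the quadratics
`(β - 1 + n) (1 + α - β + n)` and `(γ - 1 + n) (1 + α - γ + n)`. -/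
theorem sub_mul_wpNum_sub_wpLow (α β γ δ ε ζ : ℂ) (n : ℕ) :
    (β - γ) * (wpNum α (β - 1) ![γ - 1, δ, ε, ζ] n - wpLow α (β - 1) ![γ - 1, δ, ε, ζ] n) =
      (α + 2 * n) *
        ((β - γ) * (β + γ + δ + ε + ζ - 2 - 2 * α) *
            (((β - 1 + n) * (1 + α - β + n)) * ((γ - 1 + n) * (1 + α - γ + n))) +
          (β - 1) * ((β - 1 + δ - α) * (β - 1 + ε - α) * (β - 1 + ζ - α)) *
            ((γ - 1 + n) * (1 + α - γ + n)) -
          (γ - 1) * ((γ - 1 + δ - α) * (γ - 1 + ε - α) * (γ - 1 + ζ - α)) *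
            ((β - 1 + n) * (1 + α - β + n))) := by
  simp only [wpNum, wpLow, Fin.prod_univ_four, Matrix.cons_val]
  ring

/-- The coefficient of the product of both quadratics in the combination of terms that the
difference operator produces. Here `P` and `Q` are the reciprocals of the denominators of the
coefficients of the operator. -/
theorem wilson_leading_coeff {a b c d y t P Q : ℂ} (hP : P * (2 * y * (2 * y + 1)) = 1)
    (hQ : Q * (2 * y * (2 * y - 1)) = 1) :
    (a + y - 1) * ((b - y) * (c - y) * (1 - d - y) * Q) +
        ((a - y) * (b - y) * (c - y) * (d - y) * Q +
          (a + y) * (b + y) * (c + y) * (d + y) * P -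
          (((a + b + c + d - 1) / 2) ^ 2 - t ^ 2)) +
        (a - y - 1) * ((b + y) * (c + y) * (1 - d + y) * P) =
      ((3 * a + b + c - d - 1) / 2 + t + 1 - 2 * a) *
        ((a - b - c + d - 1) / 2 + t) := by
  have hD : 2 * y * (2 * y + 1) * (2 * y - 1) ≠ 0 :=
    mul_ne_zero (right_ne_zero_of_mul (hP ▸ one_ne_zero))
      (right_ne_zero_of_mul (right_ne_zero_of_mul (hQ ▸ one_ne_zero)))
  refine mul_left_cancel₀ hD ?_
  linear_combination
    ((2 * y - 1) * ((a + y) * (b + y) * (c + y) * (d + y) +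
      (a - y - 1) * ((b + y) * (c + y) * (1 - d + y)))) * hP +
    ((2 * y + 1) * ((a - y) * (b - y) * (c - y) * (d - y) +
      (a + y - 1) * ((b - y) * (c - y) * (1 - d - y)))) * hQ

/-- The algebra behind the telescoping of the terms of the difference equation, with the factors as
indeterminates: `T₁`, `T₂`, `T₃` are the terms at `x + i`, `x`, `x - i`, which are multiples of the
lowered term `h` by products of the quadratics `X` and `Y`, up to constants. -/
theorem telescoping_algebra {A₁ A₂ B G u v P Q X Y C w y κ e N h T₁ T₂ T₃ : ℂ} (hy : 2 * y ≠ 0)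
    (hP : P * (2 * y * (2 * y + 1)) = 1) (hQ : Q * (2 * y * (2 * y - 1)) = 1)
    (lead : B * (u * Q) + C + G * (v * P) = κ * e)
    (h₁ : G * (A₁ * T₁) = h * (Y * (X - (2 * y - 1) * κ)))
    (h₂ : B * G * T₂ = h * (X * Y))
    (h₃ : B * (A₂ * T₃) = h * (X * (Y + (2 * y + 1) * κ)))
    (hw : 2 * y * w = N * (2 * y * e * (X * Y) - B * u * Y + G * v * X)) :
    B * G * (A₁ * (u * Q) * (N * T₁) + C * (N * T₂) + A₂ * (v * P) * (N * T₃)) = κ * (h * w) := by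
  have quad : 2 * y * (B * (u * Q) * (Y * (X - (2 * y - 1) * κ)) + C * (X * Y) +
      G * (v * P) * (X * (Y + (2 * y + 1) * κ))) =
      κ * (2 * y * e * (X * Y) - B * u * Y + G * v * X) := by
    linear_combination 2 * y * (X * Y) * lead - Y * B * u * κ * hQ + X * G * v * κ * hP
  refine mul_left_cancel₀ hy ?_
  linear_combination 2 * y * N * B * (u * Q) * h₁ + 2 * y * N * C * h₂ +
    2 * y * N * G * (v * P) * h₃ + N * h * quad - κ * h * hw

/-- The difference operator applied to the terms of the Wilson function, up to the eigenvalue and a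
constant factor, is the telescoping expression of the series with both `a + ix` and `a - ix` lowered
by one. Here `y` stands for `ix` and `t` for `iλ`. -/
theorem wilson_term_identity {a b c d y t P Q : ℂ} (hP : P * (2 * y * (2 * y + 1)) = 1)
    (hQ : Q * (2 * y * (2 * y - 1)) = 1) {α δ ε ζ : ℂ} (hδ : δ = (a + b + c + d - 1) / 2 + t)
    (hε : ε = (a + b - c - d + 1) / 2 + t) (hζ : ζ = (a - b + c - d + 1) / 2 + t)
    (hα : α = (3 * a + b + c - d - 1) / 2 + t) (n : ℕ) :
    (a + y - 1) * (a - y - 1) *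
      ((a - y) * ((b - y) * (c - y) * (1 - d - y) * Q) *
          ((α + 2 * n) * wpSeq α (a + y - 1) ![a - y + 1, δ, ε, ζ] 0 n) +
        ((a - y) * (b - y) * (c - y) * (d - y) * Q +
          (a + y) * (b + y) * (c + y) * (d + y) * P -
          (((a + b + c + d - 1) / 2) ^ 2 - t ^ 2)) *
          ((α + 2 * n) * wpSeq α (a + y) ![a - y, δ, ε, ζ] 0 n) +
        (a + y) * ((b + y) * (c + y) * (1 - d + y) * P) *
          ((α + 2 * n) * wpSeq α (a + y + 1) ![a - y - 1, δ, ε, ζ] 0 n)) =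
      (α + 1 - 2 * a) * (wpSeq α (a + y - 1) ![a - y - 1, δ, ε, ζ] 0 n *
        (wpNum α (a + y - 1) ![a - y - 1, δ, ε, ζ] n -
          wpLow α (a + y - 1) ![a - y - 1, δ, ε, ζ] n)) := by
  have hy : 2 * y ≠ 0 := left_ne_zero_of_mul (right_ne_zero_of_mul (hP ▸ one_ne_zero))
  have r1 := wpSeq_raise_right α (a + y - 1) (a - y - 1) δ ε ζ n
  have r2 := wpSeq_raise_right α (a + y - 1) (a - y) δ ε ζ n
  have s1 := wpSeq_raise_left α (a + y - 1) ![a - y, δ, ε, ζ] n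
  have s2 := wpSeq_raise_left α (a + y - 1) ![a - y - 1, δ, ε, ζ] n
  have s3 := wpSeq_raise_left α (a + y) ![a - y - 1, δ, ε, ζ] n
  rw [sub_add_cancel] at r1 s1 s2
  have lead := wilson_leading_coeff (a := a) (b := b) (c := c) (d := d) (t := t) hP hQ
  have lagr := sub_mul_wpNum_sub_wpLow α (a + y) (a - y) δ ε ζ n
  have eX : (a + y - 1 + n) * (α - (a + y - 1) + n) =
      (a + y - 1 + n) * (1 + α - (a + y) + n) := by ring
  have eY : (a - y - 1 + n) * (α - (a - y - 1) + n) =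
      (a - y - 1 + n) * (1 + α - (a - y) + n) := by ring
  have eX' : (a - y + n) * (α - (a - y) + n) =
      (a + y - 1 + n) * (1 + α - (a + y) + n) - (2 * y - 1) * (α + 1 - 2 * a) := by ring
  have eY' : (a + y + n) * (α - (a + y) + n) =
      (a - y - 1 + n) * (1 + α - (a - y) + n) + (2 * y + 1) * (α + 1 - 2 * a) := by ring
  have hκ : (3 * a + b + c - d - 1) / 2 + t + 1 - 2 * a = α + 1 - 2 * a := by rw [hα]
  have e1 : a + y - (a - y) = 2 * y := by ring
  have e2 : a + y + (a - y) + δ + ε + ζ - 2 - 2 * α = (a - b - c + d - 1) / 2 + t := by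
    rw [hα, hδ, hε, hζ]; ring
  have e3 : (a + y - 1 + δ - α) * (a + y - 1 + ε - α) * (a + y - 1 + ζ - α) =
      -((b - y) * (c - y) * (1 - d - y)) := by
    rw [hα, hδ, hε, hζ]; ring
  have e4 : (a - y - 1 + δ - α) * (a - y - 1 + ε - α) * (a - y - 1 + ζ - α) =
      -((b + y) * (c + y) * (1 - d + y)) := by
    rw [hα, hδ, hε, hζ]; ring
  rw [eY] at r1
  rw [eX'] at r2
  rw [eX] at s1 s2
  rw [eY'] at s3
  rw [hκ] at lead
  rw [e1, e2, e3, e4, mul_neg, neg_mul, ← sub_eq_add_neg, mul_neg, neg_mul, sub_neg_eq_add] at lagr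
  refine telescoping_algebra hy hP hQ lead ?_ ?_ ?_ lagr
  · rw [r2, ← mul_assoc, r1, mul_assoc]
  · rw [mul_right_comm, s1, mul_comm _ (a - y - 1), ← mul_assoc, r1]
    generalize wpSeq α (a + y - 1) ![a - y - 1, δ, ε, ζ] 0 n = h
    rw [mul_assoc, mul_comm ((a - y - 1 + n) * _)]
  · rw [s3, ← mul_assoc, s2, mul_assoc]

theorem wilsonSeries_difference_eq {a b c d l x : ℂ} (hx : x ≠ 0) (hx₁ : x ≠ I / 2)
    (hx₂ : x ≠ -(I / 2)) (hl : 0 < (1 - dualD a b c d - I * l).re)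
    (h₁ : a + I * x - 1 ≠ 0) (h₂ : a - I * x - 1 ≠ 0) :
    coeffB a b c d (-x) * wilsonSeries a b c d l (x + I) +
        (coeffA a b c d (-x) + coeffA a b c d x - (l ^ 2 + dualA a b c d ^ 2)) *
          wilsonSeries a b c d l x +
        coeffB a b c d x * wilsonSeries a b c d l (x + -I) = 0 := by
  have hI : I ^ 2 = -1 := I_sq
  have hy : 2 * (I * x) ≠ 0 := mul_ne_zero two_ne_zero (mul_ne_zero I_ne_zero hx)
  have hp : 2 * (I * x) + 1 ≠ 0 := fun h => hx₁ (by linear_combination (-I / 2) * h + x * hI)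
  have hm : 2 * (I * x) - 1 ≠ 0 := fun h => hx₂ (by linear_combination (-I / 2) * h + x * hI)
  have hP := inv_mul_cancel₀ (mul_ne_zero hy hp)
  have hQ := inv_mul_cancel₀ (mul_ne_zero hy hm)
  set P := (2 * (I * x) * (2 * (I * x) + 1))⁻¹ with hP_def
  set Q := (2 * (I * x) * (2 * (I * x) - 1))⁻¹ with hQ_def
  set α := wilsonBase a b c d l with hα
  have dp : (2 * I * x * (2 * I * x + 1))⁻¹ = P := by rw [hP_def]; ring_nf
  have dm : (2 * I * -x * (2 * I * -x + 1))⁻¹ = Q := by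
    rw [hQ_def]; congr 1; ring
  have eA : coeffA a b c d x = (a + I * x) * (b + I * x) * (c + I * x) * (d + I * x) * P := by
    rw [coeffA, div_eq_mul_inv, dp]
  have eB : coeffB a b c d x = (a + I * x) * ((b + I * x) * (c + I * x) * (1 - d + I * x) * P) := by
    rw [coeffB, div_eq_mul_inv, dp]; ring
  have eA' : coeffA a b c d (-x) =
      (a - I * x) * (b - I * x) * (c - I * x) * (d - I * x) * Q := by
    rw [coeffA, div_eq_mul_inv, dm]; ring
  have eB' : coeffB a b c d (-x) =
      (a - I * x) * ((b - I * x) * (c - I * x) * (1 - d - I * x) * Q) := by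
    rw [coeffB, div_eq_mul_inv, dm]; ring
  have eC : coeffA a b c d (-x) + coeffA a b c d x - (l ^ 2 + dualA a b c d ^ 2) =
      (a - I * x) * (b - I * x) * (c - I * x) * (d - I * x) * Q +
        (a + I * x) * (b + I * x) * (c + I * x) * (d + I * x) * P -
        (((a + b + c + d - 1) / 2) ^ 2 - (I * l) ^ 2) := by
    rw [eA, eA', dualA]
    linear_combination -l ^ 2 * hI
  have hterm := wilson_term_identity (a := a) (b := b) (c := c) (d := d) (t := I * l) hP hQ
    (α := α) (δ := dualA a b c d + I * l) (ε := dualB a b c d + I * l)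
    (ζ := dualC a b c d + I * l) rfl rfl rfl
    (by simp only [hα, wilsonBase, dualA, dualB, dualC]; ring)
  have s₁ : a + I * (x + I) = a + I * x - 1 := by linear_combination hI
  have s₂ : a - I * (x + I) = a - I * x + 1 := by linear_combination -hI
  have s₃ : a + I * (x + -I) = a + I * x + 1 := by linear_combination -hI
  have s₄ : a - I * (x + -I) = a - I * x - 1 := by linear_combination hI
  have u₁ := summable_wilsonSeries a b c d (x + I) hl
  have u₂ := summable_wilsonSeries a b c d x hl
  have u₃ := summable_wilsonSeries a b c d (x + -I) hl
  rw [eC, eB, eB', wilsonSeries, wilsonSeries, wilsonSeries]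
  rw [s₁, s₂] at u₁ ⊢
  rw [s₃, s₄] at u₃ ⊢
  simp only [wilsonUpper, ← hα] at u₁ u₂ u₃ ⊢
  refine (mul_eq_zero.1 ?_).resolve_left (mul_ne_zero h₁ h₂)
  have hsum := (((u₁.hasSum.mul_left
    ((a - I * x) * ((b - I * x) * (c - I * x) * (1 - d - I * x) * Q))).add
    (u₂.hasSum.mul_left ((a - I * x) * (b - I * x) * (c - I * x) * (d - I * x) * Q +
      (a + I * x) * (b + I * x) * (c + I * x) * (d + I * x) * P -
      (((a + b + c + d - 1) / 2) ^ 2 - (I * l) ^ 2)))).add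
    (u₃.hasSum.mul_left
      ((a + I * x) * ((b + I * x) * (c + I * x) * (1 - d + I * x) * P)))).mul_left
    ((a + I * x - 1) * (a - I * x - 1))
  simp_rw [hterm] at hsum
  rw [← hsum.tsum_eq, tsum_mul_left]
  by_cases hκ : α + 1 - 2 * a = 0
  · rw [hκ, zero_mul]
  have hwp := isWellPoised_wpSeq α (a + I * x - 1)
    ![a - I * x - 1, dualA a b c d + I * l, dualB a b c d + I * l, dualC a b c d + I * l] 0
  rw [Nat.cast_zero, sub_zero] at hwp
  have hexc : wpExcess α (a + I * x - 1)
      ![a - I * x - 1, dualA a b c d + I * l, dualB a b c d + I * l, dualC a b c d + I * l] =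
      1 - dualD a b c d - I * l + 2 := by
    simp only [hα, wpExcess, wilsonBase, Fin.sum_univ_four, Matrix.cons_val, dualA, dualB,
      dualC, dualD]
    ring
  have htel := hwp.tsum_telescope (n₁ := 0)
    (by rw [hexc, add_re, re_ofNat]; linarith) le_rfl ((summable_mul_left_iff hκ).1 hsum.summable)
  simp only [Nat.add_zero] at htel
  rw [htel]
  simp [wpLow]

theorem wilsonFun_eq_series {a b c d l x : ℂ} (h : (l, x) ∈ wilsonDomain a b c d) :
    wilsonFun a b c d l x = Gamma (wilsonBase a b c d l) *
      ((Gamma (1 - dualD a b c d - I * l))⁻¹ * wilsonSeries a b c d l x) := by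
  rw [wilsonFun_eq a b c d x h.2.1, wilsonReg_eq_series a b c d x h.1]

/-- The difference equation for generic `x`: it holds for `λ` in an open set by telescoping, hence
for all `λ`. -/
theorem wilsonL_wilsonFun_of_generic {a b c d x : ℂ} (hx : x ≠ 0) (hx₁ : x ≠ I / 2)
    (hx₂ : x ≠ -(I / 2)) (h₁ : a + I * x - 1 ≠ 0) (h₂ : a - I * x - 1 ≠ 0) (l : ℂ) :
    wilsonL a b c d (wilsonFun a b c d l) x =
      (l ^ 2 + dualA a b c d ^ 2) * wilsonFun a b c d l x := by
  obtain ⟨l₀, hl₀, hl₁, hl₂⟩ := exists_mem_wilsonDomain a b c d x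
  have hd : ∀ y, Differentiable ℂ fun t => wilsonFun a b c d t y := fun y t =>
    differentiableAt_slice (differentiable_wilsonFun a b c d (t, y))
  have hL : Differentiable ℂ fun t => wilsonL a b c d (wilsonFun a b c d t) x := by
    simp only [wilsonL, shiftOp]
    exact (((hd _).const_mul _).add ((hd _).const_mul _)).add ((hd _).const_mul _)
  have hR : Differentiable ℂ fun t => (t ^ 2 + dualA a b c d ^ 2) * wilsonFun a b c d t x :=
    ((differentiable_id.pow 2).add_const _).mul (hd _)
  have := AnalyticOnNhd.eq_of_eventuallyEq (z₀ := l₀)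
    (hL.differentiableOn.analyticOnNhd isOpen_univ) (hR.differentiableOn.analyticOnNhd isOpen_univ)
    (by
      filter_upwards [(isOpen_setOf_mem_wilsonDomain a b c d x).mem_nhds hl₀,
        (isOpen_setOf_mem_wilsonDomain a b c d (x + I)).mem_nhds hl₁,
        (isOpen_setOf_mem_wilsonDomain a b c d (x + -I)).mem_nhds hl₂] with t ht ht₁ ht₂
      have h := wilsonSeries_difference_eq hx hx₁ hx₂ ht.1 h₁ h₂
      simp only [wilsonL, shiftOp]
      rw [wilsonFun_eq_series ht, wilsonFun_eq_series ht₁, wilsonFun_eq_series ht₂]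
      linear_combination Gamma (wilsonBase a b c d t) *
        (Gamma (1 - dualD a b c d - I * t))⁻¹ * h)
  exact congrFun this l

theorem continuousAt_coeffA (a b c d : ℂ) {x : ℂ} (hx : x ≠ 0) (hx₁ : x ≠ I / 2) :
    ContinuousAt (coeffA a b c d) x := by
  have hI : I ^ 2 = -1 := I_sq
  have hp : 2 * I * x + 1 ≠ 0 := fun h => hx₁ (by linear_combination (-I / 2) * h + x * hI)
  have : 2 * I * x * (2 * I * x + 1) ≠ 0 := by simp [hx, hp]
  unfold coeffA
  fun_prop (disch := assumption)

theorem continuousAt_coeffB (a b c d : ℂ) {x : ℂ} (hx : x ≠ 0) (hx₁ : x ≠ I / 2) :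
    ContinuousAt (coeffB a b c d) x := by
  have hI : I ^ 2 = -1 := I_sq
  have hp : 2 * I * x + 1 ≠ 0 := fun h => hx₁ (by linear_combination (-I / 2) * h + x * hI)
  have : 2 * I * x * (2 * I * x + 1) ≠ 0 := by simp [hx, hp]
  unfold coeffB
  fun_prop (disch := assumption)

theorem wilsonL_wilsonFun {a b c d x : ℂ} (hx : x ≠ 0) (hx₁ : x ≠ I / 2) (hx₂ : x ≠ -(I / 2))
    (l : ℂ) :
    wilsonL a b c d (wilsonFun a b c d l) x =
      (l ^ 2 + dualA a b c d ^ 2) * wilsonFun a b c d l x := by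
  have hf : Continuous fun y => wilsonFun a b c d l y :=
    Continuous.comp (g := fun p : ℂ × ℂ => wilsonFun a b c d p.1 p.2) (f := fun y => (l, y))
      (differentiable_wilsonFun a b c d).continuous (by fun_prop)
  have hx₃ : -x ≠ I / 2 := fun h => hx₂ (by rw [← h, neg_neg])
  have hA := (continuousAt_coeffA a b c d (neg_ne_zero.2 hx) hx₃).comp continuous_neg.continuousAt
  have hB := (continuousAt_coeffB a b c d (neg_ne_zero.2 hx) hx₃).comp continuous_neg.continuousAt
  have hL : ContinuousAt (fun y => wilsonL a b c d (wilsonFun a b c d l) y) x := by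
    have e₁ : ContinuousAt (fun y => wilsonFun a b c d l (y + I)) x :=
      (hf.comp (continuous_add_const I)).continuousAt
    have e₂ : ContinuousAt (fun y => wilsonFun a b c d l (y + -I)) x :=
      (hf.comp (continuous_add_const (-I))).continuousAt
    simp only [wilsonL, shiftOp]
    exact ((hB.mul e₁).add ((hA.add (continuousAt_coeffA a b c d hx hx₁)).mul
      hf.continuousAt)).add ((continuousAt_coeffB a b c d hx hx₁).mul e₂)
  have hR : ContinuousAt (fun y => (l ^ 2 + dualA a b c d ^ 2) * wilsonFun a b c d l y) x :=
    (hf.const_mul _).continuousAt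
  refine tendsto_nhds_unique_of_eventuallyEq (l := 𝓝[≠] x)
    (hL.tendsto.mono_left nhdsWithin_le_nhds) (hR.tendsto.mono_left nhdsWithin_le_nhds) ?_
  -- near `x`, all points other than `x` are generic
  have hne : ∀ z : ℂ, ∀ᶠ y in 𝓝[≠] x, y ≠ z := by
    intro z
    by_cases hz : z = x
    · rw [hz]; exact self_mem_nhdsWithin
    · exact nhdsWithin_le_nhds (isOpen_ne.mem_nhds (Ne.symm hz))
  have hI : I ^ 2 = -1 := I_sq
  filter_upwards [hne 0, hne (I / 2), hne (-(I / 2)), hne (I * (a - 1)), hne (-(I * (a - 1)))]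
    with y y₀ y₁ y₂ y₃ y₄
  exact wilsonL_wilsonFun_of_generic y₀ y₁ y₂
    (fun h => y₃ (by linear_combination -I * h + y * hI))
    (fun h => y₄ (by linear_combination I * h + y * hI)) l

end

theorem mainTheorem10 (a b c d : ℂ)
    (hab : NotNonposInt (a + b)) (hac : NotNonposInt (a + c)) (had : NotNonposInt (1 + a - d)) :
    (∀ l x : ℂ, (l, x) ∈ wilsonDomain a b c d → Summable (wilsonTerm a b c d l x)) ∧
    ∃ φ : ℂ → ℂ → ℂ, IsWilsonFunction a b c d φ ∧
      (∀ ψ : ℂ → ℂ → ℂ, IsWilsonFunction a b c d ψ → ψ = φ) ∧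
      ∀ l x : ℂ, x ≠ 0 → x ≠ I / 2 → x ≠ -(I / 2) →
        wilsonL a b c d (φ l) x = (l ^ 2 + dualA a b c d ^ 2) * φ l x := by
  refine ⟨fun l x h => summable_wilsonTerm hab hac had h, wilsonFun a b c d,
    isWilsonFunction_wilsonFun hab hac had,
    fun ψ hψ => (isWilsonFunction_wilsonFun hab hac had).eq hψ,
    fun l x hx hx₁ hx₂ => wilsonL_wilsonFun hx hx₁ hx₂ l⟩
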